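/- Let $k$ be a field, let $\mathfrak g$ be a Lie algebra over $k$, and let $U(\mathfrak g)$ be its enveloping algebra with its standard Hopf algebra structure (the elements of $\mathfrak g$ are primitive). Let $\tau$ be an algebra endomorphism of $U(\mathfrak g)$ and $\delta$ a $\tau$-derivation, i.e. a $k$-linear map with $\delta(ab)=\tau(a)\delta(b)+\delta(a)b$. Let $H=U(\mathfrak g)[z;\tau,\delta]$ be the Ore extension, i.e. the algebra generated by $U(\mathfrak g)$ and $z$ with the relations $za=\tau(a)z+\delta(a)$ for all $a\in U(\mathfrak g)$. Suppose that $H$ is a generalized Hopf-Ore extension of $U(\mathfrak g)$: it has a Hopf algebra structure such that $U(\mathfrak g)$ is a Hopf subalgebra and $$\Delta z=z\otimes r_1+x\otimes y+r_2\otimes z$$ for some $r_1,r_2,x,y\in U(\mathfrak g)$. Call $(r_1,r_2,x,y)$ normalized if - $x=0$ if and only if $y=0$, and - there are no $\alpha,\beta\in k\setminus\{0\}$ with $x=\alpha r_2$ and $y=\beta r_1$. If $\operatorname{char}k=p>0$, let $\hat{\mathfrak g}\subseteq U(\mathfrak g)$ be the restricted closure of $\mathfrak g$, the span of all $a^{p^r}$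 with $a\in\mathfrak g$, $r\ge 0$. **Proposition 2.3.** Under these assumptions: 1. $r_1=r_2=1$. 2. If $(r_1,r_2,x,y)$ is normalized, then $x,y\in\mathfrak g$ when $\operatorname{char}k=0$, and $x,y\in\hat{\mathfrak g}$ when $\operatorname{char}k=p>0$. 3. There is a character $\chi:\mathfrak g\to k$ of the Lie algebra $\mathfrak g$ such that $H$ is presented by the algebra $U(\mathfrak g)$, the generator $z$ and the relations $$za=(a+\chi(a))z+\delta(a)\qquad\text{for all } a\in\mathfrak g .$$ Moreover, with $\chi$ extended to an algebra map $U(\mathfrak g)\to k$, one has $\tau(a)=a+\chi(a)$ and $$\Delta\delta(a)=\delta(a)\otimes 1+1\otimes\delta(a)+[x,a]\otimes y+x\otimes[y,a]-\chi(a)\,x\otimes y$$ for all $a\in\mathfrak g$, and also for all $a\in\hat{\mathfrak g}$ when $\operatorname{char}k=p>0$. -/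

import Mathlib

open scoped TensorProduct

/-! ### The enveloping algebra as a Hopf algebra -/

namespace UniversalEnvelopingAlgebra

noncomputable section

attribute [local instance 100] LieRing.ofAssociativeRing

variable (R : Type*) (L : Type*) [CommRing R] [LieRing L] [LieAlgebra R L]

/-- The comultiplication of `U(L)`: the algebra map with `a ↦ a ⊗ 1 + 1 ⊗ a` for `a ∈ L`. -/
def comulHom : UniversalEnvelopingAlgebra R L →ₐ[R]
    UniversalEnvelopingAlgebra R L ⊗[R] UniversalEnvelopingAlgebra R L :=
  lift R
    { toFun := fun a => ι R a ⊗ₜ[R] 1 + 1 ⊗ₜ[R] ι R a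
      map_add' := fun a b => by
        simp only [map_add, TensorProduct.add_tmul, TensorProduct.tmul_add]; abel
      map_smul' := fun c a => by
        simp only [map_smul, TensorProduct.smul_tmul', TensorProduct.tmul_smul, smul_add,
          RingHom.id_apply]
      map_lie' := fun {a b} => by
        simp only [LieHom.map_lie, Ring.lie_def, mul_add, add_mul,
          Algebra.TensorProduct.tmul_mul_tmul, mul_one, one_mul, TensorProduct.sub_tmul,
          TensorProduct.tmul_sub]
        abel }

/-- The counit of `U(L)`: the algebra map with `a ↦ 0` for `a ∈ L`. -/
def counitHom : UniversalEnvelopingAlgebra R L →ₐ[R] R := lift R 0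

/-- The antipode of `U(L)`: the anti-algebra map with `a ↦ -a` for `a ∈ L`. -/
def antipodeHom : UniversalEnvelopingAlgebra R L →ₐ[R] (UniversalEnvelopingAlgebra R L)ᵐᵒᵖ :=
  lift R
    { toFun := fun a => MulOpposite.op (-ι R a)
      map_add' := fun a b => by rw [map_add, neg_add, MulOpposite.op_add]
      map_smul' := fun c a => by
        rw [map_smul, ← smul_neg, MulOpposite.op_smul, RingHom.id_apply]
      map_lie' := fun {a b} => by
        rw [LieHom.map_lie, Ring.lie_def, Ring.lie_def, ← MulOpposite.op_mul,
          ← MulOpposite.op_mul, ← MulOpposite.op_sub]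
        congr 1
        noncomm_ring }

theorem comulHom_ι (a : L) : comulHom R L (ι R a) = ι R a ⊗ₜ[R] 1 + 1 ⊗ₜ[R] ι R a :=
  lift_ι_apply R _ a

theorem counitHom_ι (a : L) : counitHom R L (ι R a) = 0 := lift_ι_apply R _ a

theorem antipodeHom_ι (a : L) : antipodeHom R L (ι R a) = MulOpposite.op (-ι R a) :=
  lift_ι_apply R _ a

variable {R L} in
theorem hom_ext_apply {B : Type*} [Ring B] [Algebra R B]
    {f g : UniversalEnvelopingAlgebra R L →ₐ[R] B} (h : ∀ a : L, f (ι R a) = g (ι R a)) :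
    f = g :=
  hom_ext R (LieHom.ext h)

instance instBialgebra : Bialgebra R (UniversalEnvelopingAlgebra R L) :=
  Bialgebra.ofAlgHom (comulHom R L) (counitHom R L)
    (by
      refine hom_ext_apply fun a => ?_
      simp [comulHom_ι, -ι_apply, TensorProduct.add_tmul, TensorProduct.tmul_add,
        Algebra.TensorProduct.one_def, add_assoc])
    (by refine hom_ext_apply fun a => ?_; simp [comulHom_ι, counitHom_ι, -ι_apply])
    (by refine hom_ext_apply fun a => ?_; simp [comulHom_ι, counitHom_ι, -ι_apply])

/-- The antipode of `U(L)` as a linear map. -/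
def antipodeLin : UniversalEnvelopingAlgebra R L →ₗ[R] UniversalEnvelopingAlgebra R L :=
  (MulOpposite.opLinearEquiv R).symm.toLinearMap ∘ₗ (antipodeHom R L).toLinearMap

theorem antipodeLin_ι (a : L) : antipodeLin R L (ι R a) = -ι R a := by
  simp [antipodeLin, antipodeHom_ι, -ι_apply]

theorem antipodeLin_one : antipodeLin R L 1 = 1 := by simp [antipodeLin]

theorem antipodeLin_mul (a b : UniversalEnvelopingAlgebra R L) :
    antipodeLin R L (a * b) = antipodeLin R L b * antipodeLin R L a := by
  simp [antipodeLin]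

variable {R L} in
theorem mem_of_ι_mem (S : Subalgebra R (UniversalEnvelopingAlgebra R L))
    (h : ∀ a : L, ι R a ∈ S) (u : UniversalEnvelopingAlgebra R L) : u ∈ S := by
  let f : L →ₗ⁅R⁆ S :=
    { toFun := fun a => ⟨ι R a, h a⟩
      map_add' := fun a b => Subtype.ext (map_add _ a b)
      map_smul' := fun c a => Subtype.ext (map_smul _ c a)
      map_lie' := fun {a b} => Subtype.ext (by
        change ι R ⁅a, b⁆ = ι R a * ι R b - ι R b * ι R a
        rw [LieHom.map_lie, Ring.lie_def]) }
  have key : S.val.comp (lift R f) = AlgHom.id R _ := by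
    refine hom_ext_apply fun a => ?_
    change ((lift R f (ι R a) : S) : UniversalEnvelopingAlgebra R L) = ι R a
    rw [lift_ι_apply]
    rfl
  have := DFunLike.congr_fun key u
  rw [← show ((lift R f u : S) : UniversalEnvelopingAlgebra R L) = u from this]
  exact (lift R f u).2

private theorem left_aux (T V : UniversalEnvelopingAlgebra R L ⊗[R] UniversalEnvelopingAlgebra R L)
    (c : R) (hT : LinearMap.mul' R _ ((antipodeLin R L).rTensor _ T) = algebraMap R _ c) :
    LinearMap.mul' R _ ((antipodeLin R L).rTensor _ (T * V)) =
      c • LinearMap.mul' R _ ((antipodeLin R L).rTensor _ V) := by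
  induction V with
  | zero => simp
  | add v w hv hw => simp only [mul_add, map_add, hv, hw, smul_add]
  | tmul p q =>
    have : LinearMap.mul' R _ ((antipodeLin R L).rTensor _ (T * p ⊗ₜ[R] q)) =
        antipodeLin R L p * LinearMap.mul' R _ ((antipodeLin R L).rTensor _ T) * q := by
      clear hT
      induction T with
      | zero => simp
      | add v w hv hw => simp only [mul_add, add_mul, map_add, hv, hw]
      | tmul r s => simp [antipodeLin_mul, mul_assoc]
    rw [this, hT, ← Algebra.commutes, mul_assoc, ← Algebra.smul_def]
    simp

private theorem right_aux (T V : UniversalEnvelopingAlgebra R L ⊗[R] UniversalEnvelopingAlgebra R L)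
    (c : R) (hV : LinearMap.mul' R _ ((antipodeLin R L).lTensor _ V) = algebraMap R _ c) :
    LinearMap.mul' R _ ((antipodeLin R L).lTensor _ (T * V)) =
      c • LinearMap.mul' R _ ((antipodeLin R L).lTensor _ T) := by
  induction T with
  | zero => simp
  | add v w hv hw => simp only [add_mul, map_add, hv, hw, smul_add]
  | tmul p q =>
    have : LinearMap.mul' R _ ((antipodeLin R L).lTensor _ (p ⊗ₜ[R] q * V)) =
        p * LinearMap.mul' R _ ((antipodeLin R L).lTensor _ V) * antipodeLin R L q := by
      clear hV
      induction V with
      | zero => simp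
      | add v w hv hw => simp only [mul_add, add_mul, map_add, hv, hw]
      | tmul r s => simp [antipodeLin_mul, mul_assoc]
    rw [this, hV, ← Algebra.commutes, mul_assoc, ← Algebra.smul_def]
    simp

/-- The standard Hopf algebra structure of `U(L)`, in which the elements of `L` are primitive. -/
instance instHopfAlgebra : HopfAlgebra R (UniversalEnvelopingAlgebra R L) where
  antipode := antipodeLin R L
  mul_antipode_rTensor_comul := by
    let S : Subalgebra R (UniversalEnvelopingAlgebra R L) :=
      { carrier := {u | LinearMap.mul' R _ ((antipodeLin R L).rTensor _ (comulHom R L u)) =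
          algebraMap R _ (counitHom R L u)}
        add_mem' := fun {a b} ha hb => by
          simp only [Set.mem_ofPred_eq] at *; simp only [map_add, ha, hb]
        mul_mem' := fun {a b} ha hb => by
          simp only [Set.mem_ofPred_eq] at *
          rw [map_mul, left_aux R L _ _ _ ha, hb, map_mul, map_mul, Algebra.smul_def]
        algebraMap_mem' := fun r => by
          simp [Algebra.algebraMap_eq_smul_one, antipodeLin_one, Algebra.TensorProduct.one_def] }
    ext u
    exact mem_of_ι_mem S (fun a => by
      change LinearMap.mul' R _ _ = _
      simp [comulHom_ι, counitHom_ι, antipodeLin_ι, antipodeLin_one, -ι_apply]) u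
  mul_antipode_lTensor_comul := by
    let S : Subalgebra R (UniversalEnvelopingAlgebra R L) :=
      { carrier := {u | LinearMap.mul' R _ ((antipodeLin R L).lTensor _ (comulHom R L u)) =
          algebraMap R _ (counitHom R L u)}
        add_mem' := fun {a b} ha hb => by
          simp only [Set.mem_ofPred_eq] at *; simp only [map_add, ha, hb]
        mul_mem' := fun {a b} ha hb => by
          simp only [Set.mem_ofPred_eq] at *
          rw [map_mul, right_aux R L _ _ _ hb, ha, map_mul, mul_comm,
            Algebra.smul_def, ← map_mul]
        algebraMap_mem' := fun r => by
          simp [Algebra.algebraMap_eq_smul_one, antipodeLin_one, Algebra.TensorProduct.one_def] }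
    ext u
    exact mem_of_ι_mem S (fun a => by
      change LinearMap.mul' R _ _ = _
      simp [comulHom_ι, counitHom_ι, antipodeLin_ι, antipodeLin_one, -ι_apply]) u

end

end UniversalEnvelopingAlgebra

namespace HopfOre

noncomputable section

/-! ### Algebras generated by an algebra and one new variable -/

section Adjoin

variable (k : Type*) {A I : Type*} [Field k] [Ring A] [Algebra k A]

/-- The relations of `k⟨A, z⟩` that make `A` a subalgebra image and impose
`z * s i = f i * z + g i` for `i : I`. In the free algebra on `Option A`, `none` is the new
variable `z` and `some a` is the generator belonging to `a ∈ A`. -/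
inductive AdjoinRel (s f g : I → A) :
    FreeAlgebra k (Option A) → FreeAlgebra k (Option A) → Prop
  | add (a b : A) : AdjoinRel s f g (FreeAlgebra.ι k (some (a + b)))
      (FreeAlgebra.ι k (some a) + FreeAlgebra.ι k (some b))
  | mul (a b : A) : AdjoinRel s f g (FreeAlgebra.ι k (some (a * b)))
      (FreeAlgebra.ι k (some a) * FreeAlgebra.ι k (some b))
  | scalar (c : k) : AdjoinRel s f g (FreeAlgebra.ι k (some (algebraMap k A c)))
      (algebraMap k _ c)
  | comm (i : I) : AdjoinRel s f g
      (FreeAlgebra.ι k none * FreeAlgebra.ι k (some (s i)))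
      (FreeAlgebra.ι k (some (f i)) * FreeAlgebra.ι k none + FreeAlgebra.ι k (some (g i)))

/-- The `k`-algebra generated by the algebra `A` and a variable `z` with the relations
`z * s i = f i * z + g i`, `i : I`. -/
abbrev AdjoinVar (s f g : I → A) := RingQuot (AdjoinRel k s f g)

/-- The image of `a : A` in `AdjoinVar k s f g`. -/
def AdjoinVar.of (s f g : I → A) (a : A) : AdjoinVar k s f g :=
  RingQuot.mkAlgHom k (AdjoinRel k s f g) (FreeAlgebra.ι k (some a))

/-- The new variable `z` in `AdjoinVar k s f g`. -/
def AdjoinVar.var (s f g : I → A) : AdjoinVar k s f g :=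
  RingQuot.mkAlgHom k (AdjoinRel k s f g) (FreeAlgebra.ι k none)

variable {k}
variable {H : Type*} [Ring H] [Algebra k H]

/-- `H` is generated by `j(A)` and `z`, and presented by the algebra `A` and the relations
`z * s i = f i * z + g i`, `i : I`. -/
def IsPresentedBy (j : A →ₐ[k] H) (z : H) (s f g : I → A) : Prop :=
  ∃ e : AdjoinVar k s f g ≃ₐ[k] H,
    (∀ a : A, e (AdjoinVar.of k s f g a) = j a) ∧ e (AdjoinVar.var k s f g) = z

/-- `δ` is a `τ`-derivation of `A`. -/
def IsTauDerivation (τ : A →ₐ[k] A) (δ : A →ₗ[k] A) : Prop :=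
  ∀ a b : A, δ (a * b) = τ a * δ b + δ a * b

/-- `H` is the Ore extension `A[z; τ, δ]`: the algebra generated by `A` and `z` with the relations
`z a = τ(a) z + δ(a)` for all `a ∈ A`, where `τ` is an algebra endomorphism and `δ` is a
`τ`-derivation. -/
def IsOreExtension (τ : A →ₐ[k] A) (δ : A →ₗ[k] A) (j : A →ₐ[k] H) (z : H) : Prop :=
  IsTauDerivation τ δ ∧ IsPresentedBy j z (fun a : A => a) (fun a => τ a) (fun a => δ a)

end Adjoin

/-! ### Generalized Hopf-Ore extensions -/

section Hopf

variable {k A H : Type*} [Field k] [Ring A] [HopfAlgebra k A] [Ring H] [HopfAlgebra k H]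

/-- The Hopf algebra `H` is the Ore extension `A[z; τ, δ]` with a Hopf algebra structure
determined by `(r₁, r₂, x, y)`: `A` is a Hopf subalgebra of `H` through `j` (a bialgebra map
between Hopf algebras commutes with the antipodes), and
`Δ z = z ⊗ r₁ + x ⊗ y + r₂ ⊗ z`. -/
structure IsGeneralizedHopfOre (τ : A →ₐ[k] A) (δ : A →ₗ[k] A) (j : A →ₐc[k] H) (z : H)
    (r₁ r₂ x y : A) : Prop where
  ore : IsOreExtension τ δ (j : A →ₐ[k] H) z
  injective : Function.Injective j
  comul_var : Coalgebra.comul (R := k) z = z ⊗ₜ[k] j r₁ + j x ⊗ₜ[k] j y + j r₂ ⊗ₜ[k] z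

variable (k) in
/-- The normalization of the data `(r₁, r₂, x, y)`: the two degenerate kinds of summand `x ⊗ y`,
which can be removed without changing the Hopf algebra, are excluded. If `x ⊗ y = 0` then
`x = y = 0` is chosen, and `x ⊗ y` is not a nonzero multiple of `r₂ ⊗ r₁`. -/
structure IsNormalized (r₁ r₂ x y : A) : Prop where
  zero_iff : x = 0 ↔ y = 0
  not_multiple : ¬ ∃ α β : k, α ≠ 0 ∧ β ≠ 0 ∧ x = α • r₂ ∧ y = β • r₁

end Hopf

/-! ### The enveloping algebra -/

section Enveloping

variable (k L : Type*) [Field k] [LieRing L] [LieAlgebra k L]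

/-- The span in `U(L)` of all `a ^ (p ^ r)` with `a ∈ L` and `r ≥ 0`. In characteristic `p > 0`
it is the restricted Lie algebra `L̂` generated by `L` in `U(L)`. -/
def hat (p : ℕ) : Submodule k (UniversalEnvelopingAlgebra k L) :=
  Submodule.span k {u | ∃ (a : L) (r : ℕ), u = UniversalEnvelopingAlgebra.ι k a ^ p ^ r}

variable {k L}

/-- `Δ δ(a) = δ(a) ⊗ 1 + 1 ⊗ δ(a) + [x, a] ⊗ y + x ⊗ [y, a] - χ(a) x ⊗ y`, for `a ∈ U(L)` and a
character `χ` of `L`, extended to an algebra map `U(L) → k`. -/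
def CoproductCondition (χ : LieAlgebra.LieCharacter k L)
    (δ : UniversalEnvelopingAlgebra k L →ₗ[k] UniversalEnvelopingAlgebra k L)
    (x y a : UniversalEnvelopingAlgebra k L) : Prop :=
  Coalgebra.comul (R := k) (δ a) =
    δ a ⊗ₜ[k] 1 + 1 ⊗ₜ[k] δ a + (x * a - a * x) ⊗ₜ[k] y + x ⊗ₜ[k] (y * a - a * y)
      - UniversalEnvelopingAlgebra.lift k χ a • (x ⊗ₜ[k] y)

end Enveloping

end

end HopfOre

/-!
The structure constants of the Hopf algebra `H` are read off from the fact that `1` and `z` are left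
independent over `U(L)`: the quotient `H / (U z² + U z³ + ⋯)` is a left `H`-module, and acting on
its generator gives linear maps `ρ, π : H → U(L)` that return the coefficients of `1` and of `z` on
elements of degree at most one (`IsOreExtension.exists_coeff`). Tensor products of `ρ` and `π`,
applied to identities in `H ⊗ H` and `H ⊗ H ⊗ H`, give identities over `U(L)`:

* coassociativity at `z` says that `r₁` and `r₂` are group-like, hence `1`, and then that
  `Δx ⊗ y + x ⊗ y ⊗ 1 = x ⊗ Δy + 1 ⊗ x ⊗ y`. So `Δx = x ⊗ u + 1 ⊗ x` for some `u`.
  Coassociativity for `x` then shows that `u` is group-like unless `x` is a scalar, so `x` is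
  primitive or a scalar, and similarly for `y`; the normalization leaves only the case of two
  primitive elements (`isPrim_of_cocycle`);
* multiplicativity of `Δ` on `z a = τ(a) z + δ(a)` for a primitive element `a` gives
  `Δ(τ(a)) = τ(a) ⊗ 1 + 1 ⊗ a`, hence `τ(a) = a + ε(τ(a))`, and the formula for `Δ(δ(a))`. The
  character is `χ = ε ∘ τ`.

It remains to know the group-like and the primitive elements of `U(L)`. Both are found without the
Poincaré-Birkhoff-Witt theorem, for any bialgebra generated by a space `P` of primitive elements.
If a functional `f` kills `1`, then `(f ⊗ id) ∘ Δ` lowers the word length filtration by one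
(`contract_mem_wordFil`), which at once excludes group-like elements other than `1`. On the
associated graded algebra, these operators are derivations. If `P` is closed under commutators, this
algebra is commutative, and for functionals dual to a basis of `P` the operators are partial
derivatives. They detect every commutative monomial of degree at least two whose exponents are less
than `p` in characteristic `p`, so such monomials are linearly independent and no combination of
them is the leading term of a primitive element. If the `p`-th powers of the basis elements lie
in `P`, these monomials span, so that `P` contains all primitive elements (`IsPrim.mem_span`). This
applies to `P = hat k L q`, where `q` is the characteristic exponent: a basis can be chosen among
the powers `a ^ q ^ r` with `a ∈ L`, and commutators of such powers are in `L` because commutation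
with `a ^ q ^ r` is the `q ^ r`-th iterate of commutation with `a`.
-/

namespace HopfOre

noncomputable section

/-! ### Word length and group-like elements -/

section Filtration

variable {k A : Type*} [Field k] [Ring A] [Bialgebra k A]

variable (k) in
/-- `a` is a primitive element of the bialgebra `A`. -/
def IsPrim (a : A) : Prop := Coalgebra.comul (R := k) a = a ⊗ₜ[k] 1 + 1 ⊗ₜ[k] a

theorem IsPrim.counit_eq_zero {a : A} (ha : IsPrim k a) : Coalgebra.counit (R := k) a = 0 := by
  have h := congrArg (fun t => Coalgebra.counit (R := k)
    (TensorProduct.lid k A ((Coalgebra.counit (R := k)).rTensor A t))) ha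
  simp only [Coalgebra.rTensor_counit_comul, map_add, LinearMap.rTensor_tmul,
    TensorProduct.lid_tmul, Bialgebra.counit_one, smul_eq_mul, map_smul, mul_one,
    one_mul] at h
  simpa using h

/-- The contraction `(f ⊗ id) ∘ Δ` of the comultiplication with a linear functional `f`. -/
def contract (f : A →ₗ[k] k) : A →ₗ[k] A :=
  (TensorProduct.lid k A).toLinearMap ∘ₗ f.rTensor A ∘ₗ Coalgebra.comul

theorem contract_one (f : A →ₗ[k] k) : contract f (1 : A) = f 1 • (1 : A) := by
  simp [contract, Algebra.TensorProduct.one_def]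

theorem contract_counit (u : A) : contract (Coalgebra.counit (R := k)) u = u := by
  simp [contract]

theorem IsPrim.contract_eq {a : A} (ha : IsPrim k a) (f : A →ₗ[k] k) :
    contract f a = f a • (1 : A) + f 1 • a := by
  have : Coalgebra.comul (R := k) a = a ⊗ₜ[k] 1 + 1 ⊗ₜ[k] a := ha
  simp [contract, this]

theorem IsPrim.contract_mul {a : A} (ha : IsPrim k a) (f : A →ₗ[k] k) (v : A) :
    contract f (a * v) = contract (f ∘ₗ LinearMap.mulLeft k a) v + a * contract f v := by
  have h : Coalgebra.comul (R := k) a = a ⊗ₜ[k] 1 + 1 ⊗ₜ[k] a := ha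
  simp only [contract, LinearMap.comp_apply, Bialgebra.comul_mul, h]
  generalize Coalgebra.comul (R := k) v = t
  induction t with
  | zero => simp
  | add s t hs ht => simp only [mul_add, map_add, hs, ht]; abel
  | tmul b c => simp [add_mul]

/-- The contraction with a functional killing `1` satisfies a Leibniz rule for multiplication by a
primitive element, up to a contraction with another functional that kills `1`. -/
theorem IsPrim.exists_contract_mul {a : A} (ha : IsPrim k a) (f : A →ₗ[k] k) :
    ∃ g : A →ₗ[k] k, g 1 = 0 ∧
      ∀ v, contract f (a * v) = f a • v + a * contract f v + contract g v := by
  refine ⟨f ∘ₗ LinearMap.mulLeft k a - f a • Coalgebra.counit, by simp, fun v => ?_⟩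
  have : contract (f ∘ₗ LinearMap.mulLeft k a - f a • Coalgebra.counit) v =
      contract (f ∘ₗ LinearMap.mulLeft k a) v - f a • v := by
    conv_rhs => rw [← contract_counit (k := k) v]
    simp [contract, LinearMap.rTensor_sub, LinearMap.rTensor_smul]
  rw [this, ha.contract_mul]
  abel

/-- The span of the products of fewer than `n` elements of `P`. The indexing makes the term of
index `0` trivial, so that contractions lower the index by one without exception. -/
def wordFil (P : Submodule k A) : ℕ → Submodule k A
  | 0 => ⊥
  | n + 1 => (1 ⊔ P) ^ n

variable {P : Submodule k A}

theorem wordFil_one : wordFil P 1 = 1 := pow_zero _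

theorem mul_mem_wordFil {m n : ℕ} {u v : A} (hu : u ∈ wordFil P (m + 1)) (hv : v ∈ wordFil P n) :
    u * v ∈ wordFil P (m + n) := by
  cases n with
  | zero => rw [show v = 0 from hv, mul_zero]; exact zero_mem _
  | succ n =>
    change u * v ∈ (1 ⊔ P) ^ (m + n)
    rw [pow_add]
    exact Submodule.mul_mem_mul hu hv

theorem mem_wordFil_two {a : A} (ha : a ∈ P) : a ∈ wordFil P 2 := by
  change a ∈ (1 ⊔ P) ^ 1
  rw [pow_one]
  exact Submodule.mem_sup_right ha

theorem one_mem_wordFil (n : ℕ) : (1 : A) ∈ wordFil P (n + 1) := by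
  have h : (1 : A) ∈ (1 ⊔ P) := Submodule.mem_sup_left (Submodule.one_le.mp le_rfl)
  have := Submodule.pow_mem_pow (1 ⊔ P) h n
  rwa [one_pow] at this

theorem wordFil_mono : Monotone (wordFil P) := by
  refine monotone_nat_of_le_succ fun n u hu => ?_
  have := mul_mem_wordFil (one_mem_wordFil 1) hu
  rwa [one_mul, add_comm] at this

theorem mul_mem_wordFil_succ {n : ℕ} {a v : A} (ha : a ∈ P) (hv : v ∈ wordFil P n) :
    a * v ∈ wordFil P (n + 1) := by
  rw [add_comm]
  exact mul_mem_wordFil (mem_wordFil_two ha) hv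

theorem wordFil_succ_induction {n : ℕ} {C : A → Prop} (hadd : ∀ u v, C u → C v → C (u + v))
    (h1 : ∀ v ∈ wordFil P (n + 1), C v) (hP : ∀ a ∈ P, ∀ v ∈ wordFil P (n + 1), C (a * v))
    {u : A} (hu : u ∈ wordFil P (n + 2)) : C u := by
  change u ∈ (1 ⊔ P) ^ (n + 1) at hu
  rw [pow_succ'] at hu
  refine Submodule.mul_induction_on hu (fun m hm v hv => ?_) hadd
  obtain ⟨c, hc, a, ha, rfl⟩ := Submodule.mem_sup.mp hm
  rw [Submodule.mem_one] at hc
  obtain ⟨c, rfl⟩ := hc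
  rw [add_mul]
  refine hadd _ _ (h1 _ ?_) (hP a ha v hv)
  rw [← Algebra.smul_def]
  exact Submodule.smul_mem _ c hv

theorem list_prod_mem_wordFil {l : List A} (hl : ∀ a ∈ l, a ∈ P) :
    l.prod ∈ wordFil P (l.length + 1) := by
  induction l with
  | nil => exact one_mem_wordFil 0
  | cons a l ih =>
    rw [List.prod_cons]
    exact mul_mem_wordFil_succ (hl a (by simp)) (ih fun b hb => hl b (by simp [hb]))

theorem exists_mem_wordFil (hP : Algebra.adjoin k (P : Set A) = ⊤) (u : A) :
    ∃ n, u ∈ wordFil P n := by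
  have hu : u ∈ Algebra.adjoin k (P : Set A) := by rw [hP]; trivial
  induction hu using Algebra.adjoin_induction with
  | mem a ha => exact ⟨2, mem_wordFil_two ha⟩
  | algebraMap c =>
    refine ⟨1, ?_⟩
    rw [wordFil_one, Submodule.mem_one]
    exact ⟨c, rfl⟩
  | add u v _ _ hu hv =>
    obtain ⟨m, hm⟩ := hu
    obtain ⟨n, hn⟩ := hv
    exact ⟨max m n, add_mem (wordFil_mono (le_max_left m n) hm)
      (wordFil_mono (le_max_right m n) hn)⟩
  | mul u v _ _ hu hv =>
    obtain ⟨m, hm⟩ := hu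
    obtain ⟨n, hn⟩ := hv
    exact ⟨m + n, mul_mem_wordFil (wordFil_mono m.le_succ hm) hn⟩

/-- A product of elements of `P` does not depend on the order of the factors, up to shorter
products, as soon as `P` is closed under commutators. -/
theorem list_prod_sub_mem_wordFil (hlie : ∀ a ∈ P, ∀ b ∈ P, a * b - b * a ∈ P) {l l' : List A}
    (h : l.Perm l') (hl : ∀ a ∈ l, a ∈ P) : l.prod - l'.prod ∈ wordFil P l.length := by
  induction h with
  | nil => simp
  | cons a h ih =>
    rw [List.prod_cons, List.prod_cons, ← mul_sub]
    exact mul_mem_wordFil_succ (hl a (by simp)) (ih fun b hb => hl b (by simp [hb]))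
  | swap a b l =>
    have := mul_mem_wordFil_succ (hlie b (hl b (by simp)) a (hl a (by simp)))
      (list_prod_mem_wordFil fun c hc => hl c (by simp [hc]) : l.prod ∈ _)
    simpa [mul_assoc, sub_mul] using this
  | trans h₁ h₂ ih₁ ih₂ =>
    have := add_mem (ih₁ hl) (h₁.length_eq ▸ ih₂ fun a ha => hl a (h₁.mem_iff.mpr ha))
    simpa using this

/-- Contractions with functionals killing `1` lower the filtration degree. -/
theorem contract_mem_wordFil (hprim : ∀ a ∈ P, IsPrim k a) {n : ℕ} {f : A →ₗ[k] k} (hf : f 1 = 0)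
    {u : A} (hu : u ∈ wordFil P (n + 1)) : contract f u ∈ wordFil P n := by
  induction n generalizing f u with
  | zero =>
    rw [wordFil_one, Submodule.mem_one] at hu
    obtain ⟨c, rfl⟩ := hu
    rw [Algebra.algebraMap_eq_smul_one, map_smul, contract_one, hf]
    simp
  | succ n ih =>
    refine wordFil_succ_induction (C := fun u => contract f u ∈ wordFil P (n + 1))
      (fun u v hu hv => ?_) (fun v hv => wordFil_mono n.le_succ (ih hf hv)) (fun a ha v hv => ?_) hu
    · rw [map_add]
      exact add_mem hu hv
    · obtain ⟨g, hg, hgv⟩ := (hprim a ha).exists_contract_mul f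
      rw [hgv]
      exact add_mem (add_mem (Submodule.smul_mem _ _ hv) (mul_mem_wordFil_succ ha (ih hf hv)))
        (wordFil_mono n.le_succ (ih hg hv))

/-- A bialgebra generated by primitive elements has no nontrivial group-like elements. -/
theorem eq_one_of_isGroupLikeElem (hprim : ∀ a ∈ P, IsPrim k a)
    (hP : Algebra.adjoin k (P : Set A) = ⊤) {g : A} (hg : IsGroupLikeElem k g) : g = 1 := by
  have hcontract (f : A →ₗ[k] k) : contract f g = f g • g := by
    simp [contract, hg.comul_eq_tmul_self]
  obtain ⟨n, hn⟩ := exists_mem_wordFil hP g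
  have hmem : g ∈ wordFil P 1 := by
    induction n with
    | zero => exact wordFil_mono zero_le_one hn
    | succ n ih =>
      by_contra h1
      have hgn : g ∉ wordFil P n := fun h => h1 (ih h)
      -- a functional that vanishes on the shorter words, hence at `1`, but not at `g`
      obtain ⟨f, hfg, hf⟩ := Submodule.exists_le_ker_of_notMem hgn
      cases n with
      | zero => exact h1 hn
      | succ n =>
        have hf1 : f 1 = 0 := hf (one_mem_wordFil n)
        have := contract_mem_wordFil hprim hf1 hn
        rw [hcontract, Submodule.smul_mem_iff _ hfg] at this
        exact hgn this
  rw [wordFil_one, Submodule.mem_one] at hmem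
  obtain ⟨c, rfl⟩ := hmem
  have := hg.counit_eq_one
  rw [Bialgebra.counit_algebraMap] at this
  rw [this, map_one]

end Filtration

/-! ### Primitive elements of a primitively generated bialgebra -/

section Words

variable {k A : Type*} [Field k] [Ring A] [Bialgebra k A]

theorem isPrim_of_mem_span {S : Set A} (hS : ∀ a ∈ S, IsPrim k a) {a : A}
    (ha : a ∈ Submodule.span k S) : IsPrim k a := by
  induction ha using Submodule.span_induction with
  | mem a ha => exact hS a ha
  | zero => simp [IsPrim]
  | add a b _ _ ha hb =>
    unfold IsPrim at *
    rw [map_add, ha, hb, TensorProduct.add_tmul, TensorProduct.tmul_add]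
    abel
  | smul c a _ ha =>
    unfold IsPrim at *
    rw [map_smul, ha, TensorProduct.tmul_smul, ← TensorProduct.smul_tmul', smul_add]

variable {I : Type*} {e : I → A}

/-- The product in `A` of the elements `e i`, `i ∈ s`, in some unspecified order. -/
def word (e : I → A) (s : Multiset I) : A := (s.toList.map e).prod

/-- A multiset is reduced over `k` if the positive multiplicities occurring in its submultisets are
nonzero in `k`: in characteristic `p` this says that all multiplicities are less than `p`. -/
def IsReduced (k : Type*) [Field k] [DecidableEq I] (s : Multiset I) : Prop :=
  ∀ i m, 0 < m → m ≤ s.count i → (m : k) ≠ 0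

theorem list_map_mem (l : List I) : ∀ a ∈ l.map e, a ∈ Submodule.span k (Set.range e) := by
  intro a ha
  obtain ⟨i, -, rfl⟩ := List.mem_map.mp ha
  exact Submodule.subset_span ⟨i, rfl⟩

theorem list_map_prod_mem_wordFil (l : List I) :
    (l.map e).prod ∈ wordFil (Submodule.span k (Set.range e)) (l.length + 1) := by
  simpa using list_prod_mem_wordFil (list_map_mem (k := k) (e := e) l)

theorem list_map_prod_sub_mem_wordFil
    (hlie : ∀ a ∈ Submodule.span k (Set.range e), ∀ b ∈ Submodule.span k (Set.range e),
      a * b - b * a ∈ Submodule.span k (Set.range e)) {l l' : List I} (h : l.Perm l') :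
    (l.map e).prod - (l'.map e).prod ∈ wordFil (Submodule.span k (Set.range e)) l.length := by
  simpa using list_prod_sub_mem_wordFil hlie (h.map e) (list_map_mem l)

variable [DecidableEq I]

/-- Up to shorter words, contraction with a functional dual to `e i` acts on words as the partial
derivative in the variable `e i`. -/
theorem contract_list_map_prod
    (hprim : ∀ i, IsPrim k (e i))
    (hlie : ∀ a ∈ Submodule.span k (Set.range e), ∀ b ∈ Submodule.span k (Set.range e),
      a * b - b * a ∈ Submodule.span k (Set.range e))
    {f : A →ₗ[k] k} {i : I} (hf : f 1 = 0) (hfe : ∀ j, f (e j) = if j = i then 1 else 0)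
    (l : List I) :
    contract f (l.map e).prod - (l.count i : k) • ((l.erase i).map e).prod ∈
      wordFil (Submodule.span k (Set.range e)) (l.length - 1) := by
  have hprim' : ∀ a ∈ Submodule.span k (Set.range e), IsPrim k a := fun a =>
    isPrim_of_mem_span (by rintro _ ⟨i, rfl⟩; exact hprim i)
  have hmem (j : I) : e j ∈ Submodule.span k (Set.range e) := Submodule.subset_span ⟨j, rfl⟩
  induction l with
  | nil => simp [contract_one, hf]
  | cons j l ih =>
    obtain ⟨g, hg, hgv⟩ := (hprim j).exists_contract_mul f
    have h1 := contract_mem_wordFil hprim' hg (list_map_prod_mem_wordFil (k := k) (e := e) l)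
    have h2 : e j * (contract f (l.map e).prod - (l.count i : k) • ((l.erase i).map e).prod) ∈
        wordFil (Submodule.span k (Set.range e)) l.length := by
      rcases l with _ | ⟨a, l⟩
      · rw [show contract f _ - _ = (0 : A) from ih, mul_zero]
        exact zero_mem _
      · exact mul_mem_wordFil_succ (hmem j) ih
    rw [List.map_cons, List.prod_cons, hgv, hfe, List.length_cons, Nat.add_sub_cancel]
    by_cases hj : j = i
    · subst hj
      have h3 : (l.count j : k) • (((j :: l.erase j).map e).prod - (l.map e).prod) ∈
          wordFil (Submodule.span k (Set.range e)) l.length := by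
        by_cases hjl : j ∈ l
        · refine Submodule.smul_mem _ _ ?_
          have h := list_map_prod_sub_mem_wordFil hlie (List.perm_cons_erase hjl).symm
          rwa [(List.perm_cons_erase hjl).symm.length_eq] at h
        · rw [List.count_eq_zero_of_not_mem hjl, Nat.cast_zero, zero_smul]
          exact zero_mem _
      convert add_mem (add_mem h1 h2) h3 using 1
      simp only [List.count_cons_self, List.erase_cons_head, List.map_cons, List.prod_cons,
        if_true, one_smul, Nat.cast_add, Nat.cast_one, add_smul, smul_sub, mul_sub,
        mul_smul_comm]
      abel
    · convert add_mem h1 h2 using 1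
      rw [List.count_cons_of_ne hj, List.erase_cons_tail (by simpa using hj), if_neg hj, zero_smul,
        List.map_cons, List.prod_cons, mul_sub, mul_smul_comm]
      abel

theorem contract_word
    (hprim : ∀ i, IsPrim k (e i))
    (hlie : ∀ a ∈ Submodule.span k (Set.range e), ∀ b ∈ Submodule.span k (Set.range e),
      a * b - b * a ∈ Submodule.span k (Set.range e))
    {f : A →ₗ[k] k} {i : I} (hf : f 1 = 0) (hfe : ∀ j, f (e j) = if j = i then 1 else 0)
    {n : ℕ} {s : Multiset I} (hs : s.card = n + 1) :
    contract f (word e s) - (s.count i : k) • word e (s.erase i) ∈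
      wordFil (Submodule.span k (Set.range e)) n := by
  have h := contract_list_map_prod hprim hlie hf hfe s.toList
  have hcount : s.toList.count i = s.count i := by
    rw [← Multiset.coe_count, Multiset.coe_toList]
  rw [Multiset.length_toList, hs, Nat.add_sub_cancel, hcount] at h
  by_cases hi : i ∈ s
  · have hperm : (s.toList.erase i).Perm (s.erase i).toList := by
      rw [← Multiset.coe_eq_coe, Multiset.coe_toList, ← Multiset.coe_erase, Multiset.coe_toList]
    have hlen : (s.toList.erase i).length = n := by
      rw [List.length_erase_of_mem (by simpa using hi), Multiset.length_toList, hs,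
        Nat.add_sub_cancel]
    have h2 := list_map_prod_sub_mem_wordFil hlie hperm
    rw [hlen] at h2
    convert add_mem h (Submodule.smul_mem _ (s.count i : k) h2) using 1
    rw [word, word, smul_sub]
    abel
  · simpa [Multiset.count_eq_zero_of_notMem hi, word] using h

theorem exists_dual (hprim : ∀ i, IsPrim k (e i)) (he : LinearIndependent k e) (i : I) :
    ∃ f : A →ₗ[k] k, f 1 = 0 ∧ ∀ j, f (e j) = if j = i then 1 else 0 := by
  obtain ⟨g, hg⟩ := LinearMap.exists_extend
    ((Finsupp.lapply i : (I →₀ k) →ₗ[k] k) ∘ₗ he.repr)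
  refine ⟨g - g 1 • Coalgebra.counit, by simp, fun j => ?_⟩
  have := LinearMap.congr_fun hg ⟨e j, Submodule.subset_span ⟨j, rfl⟩⟩
  have h2 : g (e j) = if j = i then 1 else 0 := by
    simpa [he.repr_eq_single j ⟨e j, _⟩ rfl, Finsupp.single_apply] using this
  simp [h2, (hprim j).counit_eq_zero]

theorem IsReduced.of_cons {i : I} {t : Multiset I} (h : IsReduced k (i ::ₘ t)) :
    IsReduced k t := fun j m hm hj =>
  h j m hm (hj.trans (Multiset.count_le_of_le j (Multiset.le_cons_self t i)))

/-- The induction step for the independence of the reduced words: if all partial derivatives of a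
combination of reduced words of length `n + 1` are shorter than they should be, then the
combination is trivial, provided that the reduced words of length `n` are independent. -/
theorem coeff_eq_zero_of_contract
    (hprim : ∀ i, IsPrim k (e i)) (he : LinearIndependent k e)
    (hlie : ∀ a ∈ Submodule.span k (Set.range e), ∀ b ∈ Submodule.span k (Set.range e),
      a * b - b * a ∈ Submodule.span k (Set.range e)) {n : ℕ}
    (ih : ∀ (S : Finset (Multiset I)) (c : Multiset I → k),
      (∀ s ∈ S, s.card = n ∧ IsReduced k s) →
      ∑ s ∈ S, c s • word e s ∈ wordFil (Submodule.span k (Set.range e)) n → ∀ s ∈ S, c s = 0)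
    (S : Finset (Multiset I)) (c : Multiset I → k)
    (hS : ∀ s ∈ S, s.card = n + 1 ∧ IsReduced k s)
    (h : ∀ f : A →ₗ[k] k, f 1 = 0 → contract f (∑ s ∈ S, c s • word e s) ∈
      wordFil (Submodule.span k (Set.range e)) n) :
    ∀ s ∈ S, c s = 0 := by
  intro s hs
  obtain ⟨i, hi⟩ : ∃ i, i ∈ s := Multiset.card_pos_iff_exists_mem.mp (by simp [(hS s hs).1])
  obtain ⟨f, hf, hfe⟩ := exists_dual hprim he i
  have h1 : ∑ s ∈ S, c s • (contract f (word e s) - (s.count i : k) • word e (s.erase i)) ∈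
      wordFil (Submodule.span k (Set.range e)) n :=
    Submodule.sum_mem _ fun s hs =>
      Submodule.smul_mem _ _ (contract_word hprim hlie hf hfe (hS s hs).1)
  have h2 : ∑ s ∈ S, (c s * s.count i) • word e (s.erase i) ∈
      wordFil (Submodule.span k (Set.range e)) n := by
    convert sub_mem (h f hf) h1 using 1
    rw [map_sum, ← Finset.sum_sub_distrib]
    refine Finset.sum_congr rfl fun s _ => ?_
    rw [map_smul, smul_sub, smul_smul]
    abel
  have h3 : ∑ t ∈ (S.filter (i ∈ ·)).image (·.erase i),
      (c (i ::ₘ t) * ((i ::ₘ t).count i : k)) • word e t ∈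
      wordFil (Submodule.span k (Set.range e)) n := by
    convert h2 using 1
    rw [Finset.sum_image, Finset.sum_filter]
    · refine Finset.sum_congr rfl fun s _ => ?_
      split_ifs with his
      · rw [Multiset.cons_erase his]
      · simp [Multiset.count_eq_zero_of_notMem his]
    · intro s hs t ht hst
      rw [← Multiset.cons_erase (Finset.mem_filter.mp hs).2,
        ← Multiset.cons_erase (Finset.mem_filter.mp ht).2]
      exact congrArg _ hst
  have h4 := ih _ (fun t => c (i ::ₘ t) * ((i ::ₘ t).count i : k)) (fun t ht => ?_) h3 (s.erase i)
    (Finset.mem_image_of_mem _ (Finset.mem_filter.mpr ⟨hs, hi⟩))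
  · rw [Multiset.cons_erase hi] at h4
    exact (mul_eq_zero.mp h4).resolve_right
      ((hS s hs).2 i _ (Multiset.count_pos.mpr hi) le_rfl)
  · obtain ⟨s, hs, rfl⟩ := Finset.mem_image.mp ht
    obtain ⟨hs, hi⟩ := Finset.mem_filter.mp hs
    refine ⟨?_, IsReduced.of_cons (i := i) ?_⟩
    · rw [Multiset.card_erase_of_mem hi, (hS s hs).1, Nat.pred_succ]
    · rw [Multiset.cons_erase hi]
      exact (hS s hs).2

/-- The reduced words of length `n` are linearly independent modulo shorter words. -/
theorem coeff_eq_zero_of_mem_wordFil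
    (hprim : ∀ i, IsPrim k (e i)) (he : LinearIndependent k e)
    (hlie : ∀ a ∈ Submodule.span k (Set.range e), ∀ b ∈ Submodule.span k (Set.range e),
      a * b - b * a ∈ Submodule.span k (Set.range e)) (n : ℕ)
    (S : Finset (Multiset I)) (c : Multiset I → k)
    (hS : ∀ s ∈ S, s.card = n ∧ IsReduced k s)
    (h : ∑ s ∈ S, c s • word e s ∈ wordFil (Submodule.span k (Set.range e)) n) :
    ∀ s ∈ S, c s = 0 := by
  induction n generalizing S c with
  | zero =>
    intro s hs
    have hS0 : S = {0} := Finset.eq_singleton_iff_unique_mem.mpr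
      ⟨Multiset.card_eq_zero.mp (hS s hs).1 ▸ hs, fun t ht => Multiset.card_eq_zero.mp (hS t ht).1⟩
    have h0 : c 0 • (1 : A) = 0 := by
      have h' : ∑ s ∈ S, c s • word e s = 0 := h
      simpa [hS0, word] using h'
    have := congrArg (Coalgebra.counit (R := k)) h0
    rw [Multiset.card_eq_zero.mp (hS s hs).1]
    simpa using this
  | succ n ih =>
    refine coeff_eq_zero_of_contract hprim he hlie ih S c hS fun f hf => ?_
    exact contract_mem_wordFil
      (fun a => isPrim_of_mem_span (by rintro _ ⟨i, rfl⟩; exact hprim i)) hf h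

theorem pow_mem_wordFil {P : Submodule k A} {a : A} (ha : a ∈ P) (m : ℕ) :
    a ^ m ∈ wordFil P (m + 1) := by
  rw [← List.prod_replicate]
  simpa using list_prod_mem_wordFil (P := P) (l := List.replicate m a)
    (fun b hb => (List.eq_of_mem_replicate hb) ▸ ha)

/-- If the powers `e i ^ m` with `m = 0` in `k` are combinations of shorter words, then the
reduced words span the words of length `n` modulo shorter ones. -/
theorem wordFil_succ_le
    (hlie : ∀ a ∈ Submodule.span k (Set.range e), ∀ b ∈ Submodule.span k (Set.range e),
      a * b - b * a ∈ Submodule.span k (Set.range e))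
    (hpow : ∀ i (m : ℕ), 0 < m → (m : k) = 0 → e i ^ m ∈ wordFil (Submodule.span k (Set.range e)) m)
    (n : ℕ) :
    wordFil (Submodule.span k (Set.range e)) (n + 1) ≤
      wordFil (Submodule.span k (Set.range e)) n ⊔
        Submodule.span k (word e '' {s | s.card = n ∧ IsReduced k s}) := by
  have h1 : wordFil (Submodule.span k (Set.range e)) (n + 1) ≤
      wordFil (Submodule.span k (Set.range e)) n ⊔
        Submodule.span k ((fun l : List I => (l.map e).prod) '' {l | l.length = n}) := by
    induction n with
    | zero =>
      refine le_sup_of_le_right ?_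
      rw [wordFil_one, Submodule.one_le]
      exact Submodule.subset_span ⟨[], by simp⟩
    | succ n ih =>
      refine fun u => wordFil_succ_induction (fun u v hu hv => add_mem hu hv)
        (fun v hv => Submodule.mem_sup_left hv) fun a ha v hv => ?_
      obtain ⟨w, hw, v, hv', rfl⟩ := Submodule.mem_sup.mp (ih hv)
      rw [mul_add]
      refine add_mem (Submodule.mem_sup_left (mul_mem_wordFil_succ ha hw))
        (Submodule.mem_sup_right ?_)
      have h := Submodule.mul_mem_mul ha hv'
      rw [Submodule.span_mul_span] at h
      refine Submodule.span_mono ?_ h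
      rintro _ ⟨_, ⟨i, rfl⟩, _, ⟨l, hl, rfl⟩, rfl⟩
      exact ⟨i :: l, by simpa using hl, by simp⟩
  refine h1.trans (sup_le le_sup_left (Submodule.span_le.mpr ?_))
  rintro _ ⟨l, rfl, rfl⟩
  by_cases hl : IsReduced k (l : Multiset I)
  · have h := list_map_prod_sub_mem_wordFil hlie
      (Multiset.coe_eq_coe.mp (Multiset.coe_toList (l : Multiset I)).symm)
    change (l.map e).prod ∈ _
    rw [← sub_add_cancel (l.map e).prod (word e l)]
    exact add_mem (Submodule.mem_sup_left h)
      (Submodule.mem_sup_right (Submodule.subset_span ⟨l, ⟨by simp, hl⟩, rfl⟩))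
  -- a word that is not reduced can be reordered to contain a power that is shorter
  · refine Submodule.mem_sup_left ?_
    unfold IsReduced at hl
    push Not at hl
    obtain ⟨i, m, hm, hml, hmk⟩ := hl
    rw [Multiset.coe_count, ← List.replicate_sublist_iff] at hml
    obtain ⟨l', hl'⟩ := hml.exists_perm_append
    have h := list_map_prod_sub_mem_wordFil hlie hl'
    have h2 : ((List.replicate m i ++ l').map e).prod ∈
        wordFil (Submodule.span k (Set.range e)) l.length := by
      rw [hl'.length_eq, List.map_append, List.prod_append, List.map_replicate,
        List.prod_replicate, List.length_append, List.length_replicate]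
      obtain ⟨m, rfl⟩ := Nat.exists_eq_add_of_le' hm
      rw [show m + 1 + l'.length = m + (l'.length + 1) by omega]
      exact mul_mem_wordFil (hpow i _ hm hmk) (list_map_prod_mem_wordFil l')
    simpa using add_mem h h2

/-- A bialgebra that is generated by the span of linearly independent primitive elements, closed
under commutators and with `p`-th powers of these elements in the span in characteristic `p`, has
no further primitive elements. -/
theorem IsPrim.mem_span
    (hprim : ∀ i, IsPrim k (e i)) (he : LinearIndependent k e)
    (hlie : ∀ a ∈ Submodule.span k (Set.range e), ∀ b ∈ Submodule.span k (Set.range e),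
      a * b - b * a ∈ Submodule.span k (Set.range e))
    (hpow : ∀ i (m : ℕ), 0 < m → (m : k) = 0 → e i ^ m ∈ wordFil (Submodule.span k (Set.range e)) m)
    (hgen : Algebra.adjoin k (Submodule.span k (Set.range e) : Set A) = ⊤)
    {u : A} (hu : IsPrim k u) : u ∈ Submodule.span k (Set.range e) := by
  have hprim' : ∀ a ∈ Submodule.span k (Set.range e), IsPrim k a := fun a =>
    isPrim_of_mem_span (by rintro _ ⟨i, rfl⟩; exact hprim i)
  obtain ⟨n, hn⟩ := exists_mem_wordFil hgen u
  have h2 : u ∈ wordFil (Submodule.span k (Set.range e)) 2 := by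
    induction n with
    | zero => exact wordFil_mono (Nat.zero_le 2) hn
    | succ n ih =>
      rcases lt_or_ge n 2 with h | h
      · exact wordFil_mono h hn
      obtain ⟨n, rfl⟩ := Nat.exists_eq_add_of_le' h
      obtain ⟨w, hw, v, hv, rfl⟩ := Submodule.mem_sup.mp (wordFil_succ_le hlie hpow _ hn)
      -- contractions of `u` are scalars, so the combination of longest words in `u` is trivial
      refine ih (add_mem hw ?_)
      obtain ⟨c, hc, rfl⟩ := (Finsupp.mem_span_image_iff_linearCombination k).mp hv
      rw [Finsupp.linearCombination_apply, Finsupp.sum] at hu ⊢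
      have h0 := coeff_eq_zero_of_contract hprim he hlie
        (coeff_eq_zero_of_mem_wordFil hprim he hlie (n + 1)) c.support c (fun s hs => hc hs)
        (fun f hf => ?_)
      · rw [Finset.sum_eq_zero fun s hs => by rw [h0 s hs, zero_smul]]
        exact zero_mem _
      · have h3 : contract f (w + ∑ s ∈ c.support, c s • word e s) ∈
            wordFil (Submodule.span k (Set.range e)) (n + 1) := by
          rw [hu.contract_eq, hf, zero_smul, add_zero]
          exact Submodule.smul_mem _ _ (one_mem_wordFil n)
        rw [map_add] at h3
        simpa using sub_mem h3 (contract_mem_wordFil hprim' hf hw)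
  change u ∈ (1 ⊔ _) ^ 1 at h2
  rw [pow_one] at h2
  obtain ⟨c, hc, a, ha, rfl⟩ := Submodule.mem_sup.mp h2
  obtain ⟨c, rfl⟩ := Submodule.mem_one.mp hc
  have := hu.counit_eq_zero
  rw [map_add, (hprim' a ha).counit_eq_zero, Bialgebra.counit_algebraMap, add_zero] at this
  rwa [this, map_zero, zero_add]

end Words

/-! ### Primitive and group-like elements of the enveloping algebra -/

section RestrictedClosure

attribute [local instance 100] LieRing.ofAssociativeRing

section Commutator

variable {A : Type*} [Ring A] (q : ℕ)

/-- In characteristic exponent `q`, the commutator with `a ^ q ^ r` is the `q ^ r`-th iterate of the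
commutator with `a`. -/
theorem commutator_pow_eq_iterate {k : Type*} [Field k] [Algebra k A] [ExpChar k q] (a w : A)
    (r : ℕ) : a ^ q ^ r * w - w * a ^ q ^ r = (fun v => a * v - v * a)^[q ^ r] w := by
  rcases subsingleton_or_nontrivial A with _ | _
  · exact Subsingleton.elim _ _
  have : ExpChar (A →ₗ[k] A) q := expChar_of_injective_algebraMap
    (algebraMap k (A →ₗ[k] A)).injective q
  have h := LinearMap.congr_fun (sub_pow_expChar_pow_of_commute q r
    (LinearMap.commute_mulLeft_right (R := k) a a)) w
  rw [Module.End.pow_apply, LinearMap.pow_mulLeft, LinearMap.pow_mulRight] at h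
  exact h.symm

end Commutator

variable {k L : Type*} [Field k] [LieRing L] [LieAlgebra k L]

local notation "U" => UniversalEnvelopingAlgebra k L
local notation "ι" => UniversalEnvelopingAlgebra.ι k (L := L)

theorem ι_mul_sub_mem_range (a : L) {w : U} (hw : w ∈ Set.range ι) :
    ι a * w - w * ι a ∈ Set.range ι := by
  obtain ⟨b, rfl⟩ := hw
  refine ⟨⁅a, b⁆, ?_⟩
  rw [LieHom.map_lie, LieRing.of_associative_ring_bracket]

theorem iterate_commutator_mem_range (a : L) {w : U} (hw : w ∈ Set.range ι) (n : ℕ) :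
    (fun v => ι a * v - v * ι a)^[n] w ∈ Set.range ι := by
  induction n with
  | zero => exact hw
  | succ n ih =>
    rw [Function.iterate_succ_apply']
    exact ι_mul_sub_mem_range a ih

theorem ι_mem_hat (q : ℕ) (a : L) : ι a ∈ hat k L q :=
  Submodule.subset_span ⟨a, 0, by rw [pow_zero, pow_one]⟩

variable (q : ℕ) [ExpChar k q]

theorem pow_commutator_pow_mem_range (a b : L) (r s : ℕ) :
    ι a ^ q ^ r * ι b ^ q ^ s - ι b ^ q ^ s * ι a ^ q ^ r ∈ Set.range ι := by
  have h1 : ι a ^ q ^ r * ι b - ι b * ι a ^ q ^ r ∈ Set.range ι := by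
    rw [commutator_pow_eq_iterate (k := k) q]
    exact iterate_commutator_mem_range a ⟨b, rfl⟩ _
  have h2 : ι b ^ q ^ s * ι a ^ q ^ r - ι a ^ q ^ r * ι b ^ q ^ s ∈ Set.range ι := by
    obtain ⟨n, hn⟩ := Nat.exists_eq_succ_of_ne_zero (pow_ne_zero s (expChar_ne_zero k q))
    rw [commutator_pow_eq_iterate (k := k) q, hn, Function.iterate_succ_apply]
    refine iterate_commutator_mem_range b ?_ _
    obtain ⟨c, hc⟩ := h1
    exact ⟨-c, by rw [map_neg, hc, neg_sub]⟩
  obtain ⟨c, hc⟩ := h2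
  exact ⟨-c, by rw [map_neg, hc, neg_sub]⟩

theorem commutator_mem_hat {u v : U} (hu : u ∈ hat k L q) (hv : v ∈ hat k L q) :
    u * v - v * u ∈ hat k L q := by
  induction hu, hv using Submodule.span_induction₂ with
  | mem_mem u v hu hv =>
    obtain ⟨a, r, rfl⟩ := hu
    obtain ⟨b, s, rfl⟩ := hv
    obtain ⟨c, hc⟩ := pow_commutator_pow_mem_range (k := k) q a b r s
    rw [← hc]
    exact ι_mem_hat (k := k) q c
  | zero_left => simp
  | zero_right => simp
  | add_left u u' v _ _ _ h h' =>
    rw [add_mul, mul_add, add_sub_add_comm]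
    exact add_mem h h'
  | add_right u v v' _ _ _ h h' =>
    rw [add_mul, mul_add, add_sub_add_comm]
    exact add_mem h h'
  | smul_left c u v _ _ h =>
    rw [smul_mul_assoc, mul_smul_comm, ← smul_sub]
    exact Submodule.smul_mem _ _ h
  | smul_right c u v _ _ h =>
    rw [smul_mul_assoc, mul_smul_comm, ← smul_sub]
    exact Submodule.smul_mem _ _ h

theorem isPrim_ι (a : L) : IsPrim k (ι a) := UniversalEnvelopingAlgebra.comulHom_ι k L a

theorem IsPrim.pow_expChar_pow {A : Type*} [Ring A] [Bialgebra k A] {a : A} (ha : IsPrim k a)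
    (r : ℕ) : IsPrim k (a ^ q ^ r) := by
  have : Nontrivial A := (Bialgebra.counitAlgHom k A).toRingHom.domain_nontrivial
  have : ExpChar (A ⊗[k] A) q := expChar_of_injective_algebraMap
    (algebraMap k (A ⊗[k] A)).injective q
  have hc : Commute (a ⊗ₜ[k] (1 : A)) ((1 : A) ⊗ₜ[k] a) := by simp [Commute, SemiconjBy]
  rw [IsPrim, Bialgebra.comul_pow, show Coalgebra.comul (R := k) a = _ from ha,
    add_pow_expChar_pow_of_commute _ _ hc]
  simp [Algebra.TensorProduct.tmul_pow]

theorem isPrim_of_mem_hat {u : U} (hu : u ∈ hat k L q) : IsPrim k u :=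
  isPrim_of_mem_span (by rintro _ ⟨a, r, rfl⟩; exact (isPrim_ι a).pow_expChar_pow q r)
    (show u ∈ Submodule.span k {u : U | ∃ (a : L) (r : ℕ), u = ι a ^ q ^ r} from hu)

theorem adjoin_range_ι : Algebra.adjoin k (Set.range ι) = ⊤ :=
  eq_top_iff.mpr fun u _ => UniversalEnvelopingAlgebra.mem_of_ι_mem _
    (fun a => Algebra.subset_adjoin (Set.mem_range_self a)) u

/-- In characteristic exponent `q`, the primitive elements of `U(L)` are the span of the powers
`a ^ q ^ r` with `a ∈ L`. -/
theorem mem_hat_of_isPrim {u : U} (hu : IsPrim k u) : u ∈ hat k L q := by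
  classical
  -- the basis has to consist of powers `a ^ q ^ r`, whose `q`-th powers are again in the span
  obtain ⟨b, hb, hspan, hli⟩ := exists_linearIndependent k
    {u : U | ∃ (a : L) (r : ℕ), u = ι a ^ q ^ r}
  have hP : Submodule.span k (Set.range ((↑) : b → U)) = hat k L q := by
    rw [Subtype.range_coe, hspan, hat]
  rw [← hP]
  refine hu.mem_span (fun i => ?_) hli ?_ (fun i m hm hmk => ?_) ?_
  · obtain ⟨a, r, h⟩ := hb i.2
    rw [h]
    exact (isPrim_ι a).pow_expChar_pow q r
  · rw [hP]
    exact fun u hu v hv => commutator_mem_hat q hu hv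
  · rw [hP]
    obtain ⟨a, r, h⟩ := hb i.2
    rcases ‹ExpChar k q› with _ | hq
    · exact absurd hmk (Nat.cast_ne_zero.mpr hm.ne')
    · obtain ⟨n, rfl⟩ := (CharP.cast_eq_zero_iff k q m).mp hmk
      -- `q * n` factors `a ^ q ^ r` combine to `n` factors `a ^ q ^ (r + 1)`
      have hn : 0 < n := Nat.pos_of_mul_pos_left hm
      have hle : n + 1 ≤ q * n := by nlinarith [hq.two_le]
      have ha : ι a ^ q ^ (r + 1) ∈ hat k L q := Submodule.subset_span ⟨a, r + 1, rfl⟩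
      rw [h, pow_mul, ← pow_mul (ι a), ← pow_succ]
      exact wordFil_mono hle (pow_mem_wordFil (ha) n)
  · rw [hP, eq_top_iff, ← adjoin_range_ι]
    refine Algebra.adjoin_mono ?_
    rintro _ ⟨a, rfl⟩
    exact ι_mem_hat q a

theorem exists_ι_eq_of_isPrim [CharZero k] {u : U} (hu : IsPrim k u) : ∃ a : L, u = ι a := by
  have h := mem_hat_of_isPrim 1 hu
  have hle : hat k L 1 ≤ LinearMap.range (ι : L →ₗ[k] U) := by
    refine Submodule.span_le.mpr ?_
    rintro _ ⟨a, r, rfl⟩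
    exact ⟨a, by simp⟩
  obtain ⟨a, ha⟩ := hle h
  exact ⟨a, ha.symm⟩

theorem eq_one_of_isGroupLikeElem_enveloping {g : U} (hg : IsGroupLikeElem k g) : g = 1 := by
  refine eq_one_of_isGroupLikeElem (P := Submodule.span k (Set.range ι)) (fun a =>
    isPrim_of_mem_span (by rintro _ ⟨a, rfl⟩; exact isPrim_ι a)) ?_ hg
  rw [Algebra.adjoin_span, adjoin_range_ι]

end RestrictedClosure

/-! ### Presentations of Ore extensions -/

section Presentation

variable {k A I : Type*} [Field k] [Ring A] [Algebra k A] {s f g : I → A}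

namespace AdjoinVar

variable (k) in
/-- The structure map `A → k⟨A, z⟩` as a homomorphism of algebras. -/
def ofHom (s f g : I → A) : A →ₐ[k] AdjoinVar k s f g :=
  AlgHom.ofLinearMap
    { toFun := of k s f g
      map_add' := fun a b => by
        simpa [of] using RingQuot.mkAlgHom_rel k (AdjoinRel.add (s := s) (f := f) (g := g) a b)
      map_smul' := fun c a => by
        have h1 := RingQuot.mkAlgHom_rel k
          (AdjoinRel.mul (k := k) (s := s) (f := f) (g := g) (algebraMap k A c) a)
        have h2 := RingQuot.mkAlgHom_rel k
          (AdjoinRel.scalar (k := k) (s := s) (f := f) (g := g) c)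
        rw [map_mul, h2, AlgHom.commutes, ← Algebra.smul_def, ← Algebra.smul_def] at h1
        exact h1 }
    (by
      have h := RingQuot.mkAlgHom_rel k
        (AdjoinRel.scalar (k := k) (s := s) (f := f) (g := g) 1)
      rw [map_one, map_one, map_one] at h
      exact h)
    (fun a b => by
      have h := RingQuot.mkAlgHom_rel k (AdjoinRel.mul (k := k) (s := s) (f := f) (g := g) a b)
      rw [map_mul] at h
      exact h)

theorem var_mul_ofHom (i : I) : var k s f g * ofHom k s f g (s i) =
    ofHom k s f g (f i) * var k s f g + ofHom k s f g (g i) := by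
  have h := RingQuot.mkAlgHom_rel k (AdjoinRel.comm (k := k) (s := s) (f := f) (g := g) i)
  rw [map_add, map_mul, map_mul] at h
  exact h

variable {B : Type*} [Ring B] [Algebra k B]

/-- The universal property of `AdjoinVar`. -/
def lift (φ : A →ₐ[k] B) (w : B) (h : ∀ i, w * φ (s i) = φ (f i) * w + φ (g i)) :
    AdjoinVar k s f g →ₐ[k] B :=
  RingQuot.liftAlgHom k ⟨FreeAlgebra.lift k (fun o : Option A => o.elim w φ), fun u v huv => by
    induction huv <;> simp [h]⟩

theorem lift_ofHom (φ : A →ₐ[k] B) (w : B) (h : ∀ i, w * φ (s i) = φ (f i) * w + φ (g i)) (a : A) :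
    lift φ w h (ofHom k s f g a) = φ a := by
  change lift φ w h (of k s f g a) = φ a
  simp [lift, of]

theorem lift_var (φ : A →ₐ[k] B) (w : B) (h : ∀ i, w * φ (s i) = φ (f i) * w + φ (g i)) :
    lift φ w h (var k s f g) = w := by
  simp [lift, var]

theorem hom_ext {φ ψ : AdjoinVar k s f g →ₐ[k] B}
    (hof : ∀ a, φ (ofHom k s f g a) = ψ (ofHom k s f g a))
    (hvar : φ (var k s f g) = ψ (var k s f g)) : φ = ψ := by
  refine RingQuot.ringQuot_ext' k _ _ (FreeAlgebra.hom_ext (funext fun o => ?_))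
  cases o with
  | none => exact hvar
  | some a => exact hof a

end AdjoinVar

variable {H : Type*} [Ring H] [Algebra k H] {τ : A →ₐ[k] A} {δ : A →ₗ[k] A} {j : A →ₐ[k] H} {z : H}

theorem IsTauDerivation.map_one (hδ : IsTauDerivation τ δ) : δ 1 = 0 := by
  simpa using hδ 1 1

theorem IsTauDerivation.map_algebraMap (hδ : IsTauDerivation τ δ) (c : k) :
    δ (algebraMap k A c) = 0 := by
  rw [Algebra.algebraMap_eq_smul_one, map_smul, hδ.map_one, smul_zero]

theorem IsOreExtension.mul_map (h : IsOreExtension τ δ j z) (a : A) :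
    z * j a = j (τ a) * z + j (δ a) := by
  obtain ⟨-, e, he, hz⟩ := h
  have h := congrArg e (AdjoinVar.var_mul_ofHom (k := k) (s := fun a : A => a)
    (f := fun a => τ a) (g := fun a => δ a) a)
  rw [map_add, map_mul, map_mul, hz] at h
  rw [← he, ← he, ← he]
  exact h

/-- The relations of an Ore extension follow from those for algebra generators of the base. -/
theorem IsOreExtension.isPresentedBy (h : IsOreExtension τ δ j z)
    (hs : Algebra.adjoin k (Set.range s) = ⊤) :
    IsPresentedBy j z s (fun i => τ (s i)) (fun i => δ (s i)) := by
  have hmul := h.mul_map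
  obtain ⟨hδ, e, he, hz⟩ := h
  let o := AdjoinVar.ofHom k s (fun i => τ (s i)) (fun i => δ (s i))
  let w := AdjoinVar.var k s (fun i => τ (s i)) (fun i => δ (s i))
  have hrel (a : A) : w * o a = o (τ a) * w + o (δ a) := by
    have ha : a ∈ Algebra.adjoin k (Set.range s) := by rw [hs]; trivial
    induction ha using Algebra.adjoin_induction with
    | mem a ha =>
      obtain ⟨i, rfl⟩ := ha
      exact AdjoinVar.var_mul_ofHom i
    | algebraMap c =>
      rw [hδ.map_algebraMap, map_zero, add_zero, AlgHom.commutes, AlgHom.commutes,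
        (Algebra.commutes c w).symm, AlgHom.commutes]
    | add a b _ _ ha hb =>
      simp only [map_add, mul_add, add_mul, ha, hb]
      abel
    | mul a b _ _ ha hb =>
      rw [map_mul, ← mul_assoc, ha, add_mul, mul_assoc, hb, hδ a b, map_mul, map_add, map_mul,
        map_mul, map_mul]
      noncomm_ring
  let φ := AdjoinVar.lift (s := s) (f := fun i => τ (s i)) (g := fun i => δ (s i)) j z
    (fun i => hmul (s i))
  let ψ := AdjoinVar.lift (s := fun a : A => a) (f := fun a => τ a) (g := fun a => δ a) o w hrel
  have hφψ : φ.comp ψ = e := AdjoinVar.hom_ext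
    (fun a => by
      rw [AlgHom.comp_apply, AdjoinVar.lift_ofHom, AdjoinVar.lift_ofHom]
      exact (he a).symm)
    (by
      rw [AlgHom.comp_apply, AdjoinVar.lift_var, AdjoinVar.lift_var]
      exact hz.symm)
  refine ⟨AlgEquiv.ofAlgHom φ (ψ.comp e.symm) ?_ ?_, fun a => AdjoinVar.lift_ofHom _ _ _ a,
    AdjoinVar.lift_var _ _ _⟩
  · rw [← AlgHom.comp_assoc, hφψ]
    ext x
    simp
  · refine AdjoinVar.hom_ext (fun a => ?_) ?_
    · change ψ (e.symm (φ (o a))) = o a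
      rw [AdjoinVar.lift_ofHom, ← he a, AlgEquiv.symm_apply_apply]
      exact AdjoinVar.lift_ofHom _ _ _ a
    · change ψ (e.symm (φ w)) = w
      rw [AdjoinVar.lift_var, ← hz, AlgEquiv.symm_apply_apply]
      exact AdjoinVar.lift_var _ _ _

/-- The coefficient functions of `1` and `z` on an Ore extension, on elements of degree at most
one in `z`. -/
theorem IsOreExtension.exists_coeff (h : IsOreExtension τ δ j z) :
    ∃ ρ π : H →ₗ[k] A, (∀ a, ρ (j a) = a) ∧ (∀ a, ρ (j a * z) = 0) ∧
      (∀ a, π (j a) = 0) ∧ (∀ a, π (j a * z) = a) := by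
  obtain ⟨hδ, e, he, hz⟩ := h
  -- `H` acts on `H / (A z² + A z³ + ⋯)`, which is `A ⊕ A z` as a module over `A`
  let w : Module.End k (A × A) := LinearMap.prod (δ ∘ₗ LinearMap.fst k A A)
    (τ.toLinearMap ∘ₗ LinearMap.fst k A A + δ ∘ₗ LinearMap.snd k A A)
  let o : A →ₐ[k] Module.End k (A × A) := Algebra.lsmul k k (A × A)
  let ψ := AdjoinVar.lift (s := fun a : A => a) (f := fun a => τ a) (g := fun a => δ a) o w (by
    intro a
    refine LinearMap.ext fun b => Prod.ext ?_ ?_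
    · simp [w, o, hδ a b.1]
    · simp only [w, o, Module.End.mul_apply, LinearMap.add_apply, Algebra.lsmul_coe]
      simp [hδ a b.2, mul_add, add_assoc])
  let ev : H →ₗ[k] A × A := LinearMap.applyₗ (1, 0) ∘ₗ (ψ.comp e.symm.toAlgHom).toLinearMap
  have hsymm (a : A) : e.symm (j a) = AdjoinVar.ofHom k _ _ _ a := by
    rw [← he, AlgEquiv.symm_apply_apply]
    rfl
  have hevj (a : A) : ev (j a) = (a, 0) := by
    change ψ (e.symm (j a)) (1, 0) = _
    rw [hsymm, AdjoinVar.lift_ofHom]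
    simp [o]
  have hevz (a : A) : ev (j a * z) = (0, a) := by
    change ψ (e.symm (j a * z)) (1, 0) = _
    rw [map_mul, hsymm, ← hz, AlgEquiv.symm_apply_apply, map_mul, AdjoinVar.lift_ofHom,
      AdjoinVar.lift_var]
    simp [o, w, hδ.map_one]
  refine ⟨LinearMap.fst k A A ∘ₗ ev, LinearMap.snd k A A ∘ₗ ev, fun a => ?_, fun a => ?_,
    fun a => ?_, fun a => ?_⟩ <;> simp [hevj, hevz]

end Presentation

/-! ### Coproducts on generalized Hopf-Ore extensions -/

section SkewPrimitive

variable {k A : Type*} [Field k] [Ring A] [Bialgebra k A]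

/-- If `A` has no nontrivial group-like elements, then an element with `Δ x = x ⊗ u + 1 ⊗ x` is
primitive or a scalar. -/
theorem isPrim_or_scalar_of_comul_right (hG : ∀ g : A, IsGroupLikeElem k g → g = 1) {x u : A}
    (hx : Coalgebra.comul (R := k) x = x ⊗ₜ[k] u + 1 ⊗ₜ[k] x) :
    IsPrim k x ∨ ∃ c : k, x = c • (1 : A) := by
  have h1 := congrArg (TensorProduct.lid k A) (Coalgebra.rTensor_counit_comul (R := k) x)
  have h2 := congrArg (TensorProduct.rid k A) (Coalgebra.lTensor_counit_comul (R := k) x)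
  simp only [hx, map_add, LinearMap.rTensor_tmul, LinearMap.lTensor_tmul, TensorProduct.lid_tmul,
    TensorProduct.rid_tmul, Bialgebra.counit_one, one_smul, add_eq_right] at h1 h2
  rcases smul_eq_zero.mp h1 with h1 | h1
  · rw [h1, zero_smul, add_zero] at h2
    by_cases hx0 : x = 0
    · exact Or.inr ⟨0, by rw [hx0, zero_smul]⟩
    have hu : Coalgebra.counit (R := k) u = 1 := by
      by_contra h
      have : (Coalgebra.counit (R := k) u - 1) • x = 0 := by rw [sub_smul, h2, one_smul, sub_self]
      exact (smul_eq_zero.mp this).elim (fun h' => h (sub_eq_zero.mp h')) hx0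
    obtain ⟨f, hf⟩ := Module.Projective.exists_dual_eq_one k hx0
    have h3 := Coalgebra.coassoc_apply (R := k) x
    simp only [hx, map_add, LinearMap.rTensor_tmul, LinearMap.lTensor_tmul, TensorProduct.add_tmul,
      TensorProduct.tmul_add, TensorProduct.assoc_tmul, Bialgebra.comul_one,
      Algebra.TensorProduct.one_def] at h3
    rw [add_assoc, add_left_inj] at h3
    have h4 := congrArg (TensorProduct.lid k (A ⊗[k] A) ∘ f.rTensor (A ⊗[k] A)) h3
    simp only [Function.comp_apply, LinearMap.rTensor_tmul, TensorProduct.lid_tmul, hf,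
      one_smul] at h4
    left
    rw [IsPrim, hx, hG u ⟨hu, h4.symm⟩]
  · rw [h1, map_zero, zero_smul, zero_add] at h2
    exact Or.inr ⟨_, h2.symm⟩

/-- If `A` has no nontrivial group-like elements, then an element with `Δ y = y ⊗ 1 + u ⊗ y` is
primitive or a scalar. -/
theorem isPrim_or_scalar_of_comul_left (hG : ∀ g : A, IsGroupLikeElem k g → g = 1) {y u : A}
    (hy : Coalgebra.comul (R := k) y = y ⊗ₜ[k] 1 + u ⊗ₜ[k] y) :
    IsPrim k y ∨ ∃ c : k, y = c • (1 : A) := by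
  have h1 := congrArg (TensorProduct.lid k A) (Coalgebra.rTensor_counit_comul (R := k) y)
  have h2 := congrArg (TensorProduct.rid k A) (Coalgebra.lTensor_counit_comul (R := k) y)
  simp only [hy, map_add, LinearMap.rTensor_tmul, LinearMap.lTensor_tmul, TensorProduct.lid_tmul,
    TensorProduct.rid_tmul, Bialgebra.counit_one, one_smul, add_eq_left] at h1 h2
  rcases smul_eq_zero.mp h2 with h2 | h2
  · rw [h2, zero_smul, zero_add] at h1
    by_cases hy0 : y = 0
    · exact Or.inr ⟨0, by rw [hy0, zero_smul]⟩
    have hu : Coalgebra.counit (R := k) u = 1 := by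
      by_contra h
      have : (Coalgebra.counit (R := k) u - 1) • y = 0 := by rw [sub_smul, h1, one_smul, sub_self]
      exact (smul_eq_zero.mp this).elim (fun h' => h (sub_eq_zero.mp h')) hy0
    obtain ⟨f, hf⟩ := Module.Projective.exists_dual_eq_one k hy0
    have h3 := Coalgebra.coassoc_apply (R := k) y
    simp only [hy, map_add, LinearMap.rTensor_tmul, LinearMap.lTensor_tmul, TensorProduct.add_tmul,
      TensorProduct.tmul_add, TensorProduct.assoc_tmul, Bialgebra.comul_one,
      Algebra.TensorProduct.one_def] at h3
    rw [add_assoc, add_right_inj, add_right_inj] at h3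
    have h4 := congrArg (TensorProduct.rid k (A ⊗[k] A) ∘ f.lTensor (A ⊗[k] A) ∘
      (TensorProduct.assoc k A A A).symm) h3
    simp only [Function.comp_apply, LinearEquiv.symm_apply_apply, TensorProduct.assoc_symm_tmul,
      LinearMap.lTensor_tmul, TensorProduct.rid_tmul, hf, one_smul] at h4
    left
    rw [IsPrim, hy, hG u ⟨hu, h4⟩]
  · rw [h2, map_zero, zero_smul, add_zero] at h1
    exact Or.inr ⟨_, h1.symm⟩

/-- The cocycle equation forced on `x ⊗ y` by the coassociativity at a variable with
`Δ z = z ⊗ 1 + x ⊗ y + 1 ⊗ z` makes each of `x` and `y` primitive or scalar; the mixed cases are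
impossible, and the case of two nonzero scalars is excluded by normalization. -/
theorem isPrim_of_cocycle (hG : ∀ g : A, IsGroupLikeElem k g → g = 1) {x y : A}
    (hxy : TensorProduct.assoc k A A A (Coalgebra.comul (R := k) x ⊗ₜ[k] y) + x ⊗ₜ[k] (y ⊗ₜ[k] 1) =
      x ⊗ₜ[k] Coalgebra.comul (R := k) y + 1 ⊗ₜ[k] (x ⊗ₜ[k] y))
    (h0 : x = 0 ↔ y = 0)
    (hs : ¬ ∃ α β : k, α ≠ 0 ∧ β ≠ 0 ∧ x = α • (1 : A) ∧ y = β • (1 : A)) : IsPrim k x ∧ IsPrim k y := by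
  by_cases hx0 : x = 0
  · have hy0 := h0.mp hx0
    simp [IsPrim, hx0, hy0]
  have hy0 : y ≠ 0 := fun h => hx0 (h0.mpr h)
  have hx : IsPrim k x ∨ ∃ c : k, x = c • (1 : A) := by
    obtain ⟨f, hf⟩ := Module.Projective.exists_dual_eq_one k hy0
    have h := congrArg (TensorProduct.rid k (A ⊗[k] A) ∘ f.lTensor (A ⊗[k] A) ∘
      (TensorProduct.assoc k A A A).symm) hxy
    simp only [Function.comp_apply, map_add, LinearEquiv.symm_apply_apply,
      TensorProduct.assoc_symm_tmul, LinearMap.lTensor_tmul, TensorProduct.rid_tmul, hf,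
      one_smul] at h
    have hT (t : A ⊗[k] A) : TensorProduct.rid k (A ⊗[k] A) (f.lTensor (A ⊗[k] A)
        ((TensorProduct.assoc k A A A).symm (x ⊗ₜ[k] t))) =
        x ⊗ₜ[k] TensorProduct.rid k A (f.lTensor A t) := by
      induction t with
      | zero => simp
      | add s t hs ht => simp only [TensorProduct.tmul_add, map_add, hs, ht]
      | tmul a b => simp
    rw [hT, ← TensorProduct.tmul_smul] at h
    refine isPrim_or_scalar_of_comul_right hG (u := TensorProduct.rid k A (f.lTensor A
      (Coalgebra.comul y)) - f 1 • y) ?_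
    rw [TensorProduct.tmul_sub, eq_sub_of_add_eq h]
    abel
  have hy : IsPrim k y ∨ ∃ c : k, y = c • (1 : A) := by
    obtain ⟨f, hf⟩ := Module.Projective.exists_dual_eq_one k hx0
    have h := congrArg (TensorProduct.lid k (A ⊗[k] A) ∘ f.rTensor (A ⊗[k] A)) hxy
    simp only [Function.comp_apply, map_add, LinearMap.rTensor_tmul, TensorProduct.lid_tmul, hf,
      one_smul] at h
    have hT (t : A ⊗[k] A) : TensorProduct.lid k (A ⊗[k] A) (f.rTensor (A ⊗[k] A)
        (TensorProduct.assoc k A A A (t ⊗ₜ[k] y))) =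
        TensorProduct.lid k A (f.rTensor A t) ⊗ₜ[k] y := by
      induction t with
      | zero => simp
      | add s t hs ht => simp only [TensorProduct.add_tmul, map_add, hs, ht]
      | tmul a b => simp [TensorProduct.smul_tmul']
    rw [hT, TensorProduct.smul_tmul'] at h
    refine isPrim_or_scalar_of_comul_left hG (u := TensorProduct.lid k A (f.rTensor A
      (Coalgebra.comul x)) - f 1 • x) ?_
    rw [TensorProduct.sub_tmul, ← sub_eq_of_eq_add h]
    abel
  have hunit : Coalgebra.counit (R := k) (1 : A) = 1 := Bialgebra.counit_one
  have h1 : Coalgebra.comul (R := k) (1 : A) = 1 ⊗ₜ[k] 1 := by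
    rw [Bialgebra.comul_one, Algebra.TensorProduct.one_def]
  rcases hx with hx | ⟨α, rfl⟩
  · refine ⟨hx, hy.resolve_right ?_⟩
    rintro ⟨β, rfl⟩
    have hβ : β ≠ 0 := fun h => hy0 (by rw [h, zero_smul])
    rw [show Coalgebra.comul (R := k) x = _ from hx, map_smul, h1] at hxy
    have h := congrArg (TensorProduct.rid k A ∘ (TensorProduct.lid k k ∘ₗ TensorProduct.map
      (Coalgebra.counit (R := k) (A := A)) (Coalgebra.counit (R := k))).lTensor A) hxy
    simp [TensorProduct.add_tmul, hunit, hx.counit_eq_zero, hβ] at h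
    exact hx0 h
  · have hα : α ≠ 0 := fun h => hx0 (by rw [h, zero_smul])
    rcases hy with hy | ⟨β, rfl⟩
    · rw [show Coalgebra.comul (R := k) y = _ from hy, map_smul, h1] at hxy
      have h := congrArg (TensorProduct.lid k A ∘ TensorProduct.map (Coalgebra.counit (R := k))
        ((TensorProduct.lid k A).toLinearMap ∘ₗ (Coalgebra.counit (R := k)).rTensor A)) hxy
      simp [TensorProduct.tmul_add, ← TensorProduct.smul_tmul', hunit, hy.counit_eq_zero, hα] at h
      exact absurd h hy0
    · exact absurd ⟨α, β, hα, fun h => hy0 (by rw [h, zero_smul]), rfl, rfl⟩ hs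

end SkewPrimitive

section Coproduct

variable {k A H : Type*} [Field k] [Ring A] [HopfAlgebra k A] [Ring H] [HopfAlgebra k H]
  {τ : A →ₐ[k] A} {δ : A →ₗ[k] A} {j : A →ₐc[k] H} {z : H} {r₁ r₂ x y : A}

theorem comul_map (j : A →ₐc[k] H) (a : A) : Coalgebra.comul (R := k) (j a) =
    TensorProduct.map (j : A →ₗ[k] H) (j : A →ₗ[k] H) (Coalgebra.comul (R := k) a) :=
  (CoalgHomClass.map_comp_comul_apply j a).symm

theorem map_map_assoc_tmul {M N : Type*} [AddCommGroup M] [Module k M] [AddCommGroup N] [Module k N]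
    (f g h : M →ₗ[k] N) (t : M ⊗[k] M) (w : M) :
    TensorProduct.map f (TensorProduct.map g h) (TensorProduct.assoc k M M M (t ⊗ₜ[k] w)) =
      TensorProduct.assoc k N N N (TensorProduct.map f g t ⊗ₜ[k] h w) := by
  induction t with
  | zero => simp
  | add s t hs ht => simp only [TensorProduct.add_tmul, map_add, hs, ht]
  | tmul a b => simp

theorem map_comul_map (j : A →ₐc[k] H) (f g : H →ₗ[k] A) (a : A) :
    TensorProduct.map f g (Coalgebra.comul (R := k) (j a)) =
      TensorProduct.map (f ∘ₗ (j : A →ₗ[k] H)) (g ∘ₗ (j : A →ₗ[k] H))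
        (Coalgebra.comul (R := k) a) := by
  rw [comul_map, TensorProduct.map_comp, LinearMap.comp_apply]

namespace IsGeneralizedHopfOre

variable (h : IsGeneralizedHopfOre τ δ j z r₁ r₂ x y)
include h

theorem exists_coeff : ∃ ρ π : H →ₗ[k] A, (∀ a, ρ (j a) = a) ∧ (∀ a, ρ (j a * z) = 0) ∧
    (∀ a, π (j a) = 0) ∧ (∀ a, π (j a * z) = a) :=
  h.ore.exists_coeff

/-- Coassociativity at `z`, as an equation in `H ⊗ (H ⊗ H)`. -/
theorem coassoc_var :
    TensorProduct.assoc k H H H (Coalgebra.comul (R := k) z ⊗ₜ[k] j r₁) +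
      TensorProduct.assoc k H H H (Coalgebra.comul (R := k) (j x) ⊗ₜ[k] j y) +
      TensorProduct.assoc k H H H (Coalgebra.comul (R := k) (j r₂) ⊗ₜ[k] z) =
    z ⊗ₜ[k] Coalgebra.comul (R := k) (j r₁) + j x ⊗ₜ[k] Coalgebra.comul (R := k) (j y) +
      j r₂ ⊗ₜ[k] Coalgebra.comul (R := k) z := by
  have h3 := Coalgebra.coassoc_apply (R := k) z
  conv at h3 => lhs; rw [h.comul_var]
  conv at h3 => rhs; rw [h.comul_var]
  simpa only [map_add, LinearMap.rTensor_tmul, LinearMap.lTensor_tmul] using h3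

theorem isGroupLikeElem_left : IsGroupLikeElem k r₁ := by
  obtain ⟨ρ, π, hρ, hρz, hπ, hπz⟩ := h.exists_coeff
  have hz : π z = 1 := by simpa using hπz 1
  have hρj : ρ ∘ₗ (j : A →ₗ[k] H) = LinearMap.id := LinearMap.ext hρ
  have hπj : π ∘ₗ (j : A →ₗ[k] H) = 0 := LinearMap.ext hπ
  refine ⟨?_, ?_⟩
  · have h1 := congrArg (π ∘ TensorProduct.rid k H) (Coalgebra.lTensor_counit_comul (R := k) z)
    simp only [h.comul_var, Function.comp_apply, map_add, LinearMap.lTensor_tmul,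
      TensorProduct.rid_tmul, map_smul, hπ, hz, CoalgHomClass.counit_comp_apply, one_smul,
      smul_zero, add_zero] at h1
    simpa using congrArg (Coalgebra.counit (R := k)) h1
  · have h1 := congrArg (TensorProduct.map π (TensorProduct.map ρ ρ)) h.coassoc_var
    simp only [map_add, map_map_assoc_tmul, TensorProduct.map_tmul, map_comul_map, hρj, hπj,
      h.comul_var, hz, hπ, hρ, TensorProduct.map_zero_left, TensorProduct.map_id,
      LinearMap.zero_apply, LinearMap.id_apply, TensorProduct.zero_tmul, TensorProduct.assoc_tmul,
      TensorProduct.add_tmul, map_zero, add_zero] at h1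
    have h2 := congrArg (TensorProduct.lid k (A ⊗[k] A) ∘
      (Coalgebra.counit (R := k) (A := A)).rTensor (A ⊗[k] A)) h1
    simpa using h2.symm

theorem isGroupLikeElem_right : IsGroupLikeElem k r₂ := by
  obtain ⟨ρ, π, hρ, hρz, hπ, hπz⟩ := h.exists_coeff
  have hz : π z = 1 := by simpa using hπz 1
  have hρj : ρ ∘ₗ (j : A →ₗ[k] H) = LinearMap.id := LinearMap.ext hρ
  have hπj : π ∘ₗ (j : A →ₗ[k] H) = 0 := LinearMap.ext hπ
  refine ⟨?_, ?_⟩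
  · have h1 := congrArg (π ∘ TensorProduct.lid k H) (Coalgebra.rTensor_counit_comul (R := k) z)
    simp only [h.comul_var, Function.comp_apply, map_add, LinearMap.rTensor_tmul,
      TensorProduct.lid_tmul, map_smul, hπ, hz, CoalgHomClass.counit_comp_apply, one_smul,
      smul_zero, zero_add] at h1
    simpa using congrArg (Coalgebra.counit (R := k)) h1
  · have h1 := congrArg (TensorProduct.map ρ (TensorProduct.map ρ π)) h.coassoc_var
    simp only [map_add, map_map_assoc_tmul, TensorProduct.map_tmul, map_comul_map, hρj, hπj,
      h.comul_var, hz, hπ, hρ, TensorProduct.map_zero_right, TensorProduct.map_id,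
      LinearMap.zero_apply, LinearMap.id_apply, TensorProduct.tmul_zero, TensorProduct.tmul_add,
      map_zero, zero_add] at h1
    have h2 := congrArg (TensorProduct.rid k (A ⊗[k] A) ∘
      (Coalgebra.counit (R := k) (A := A)).lTensor (A ⊗[k] A) ∘
      (TensorProduct.assoc k A A A).symm) h1
    simpa using h2

end IsGeneralizedHopfOre

variable (h : IsGeneralizedHopfOre τ δ j z 1 1 x y)
include h

namespace IsGeneralizedHopfOre

theorem cocycle :
    TensorProduct.assoc k A A A (Coalgebra.comul (R := k) x ⊗ₜ[k] y) + x ⊗ₜ[k] (y ⊗ₜ[k] 1) =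
      x ⊗ₜ[k] Coalgebra.comul (R := k) y + 1 ⊗ₜ[k] (x ⊗ₜ[k] y) := by
  obtain ⟨ρ, π, hρ, hρz, hπ, hπz⟩ := h.exists_coeff
  have hz : ρ z = 0 := by simpa using hρz 1
  have hρj : ρ ∘ₗ (j : A →ₗ[k] H) = LinearMap.id := LinearMap.ext hρ
  have h1 := congrArg (TensorProduct.map ρ (TensorProduct.map ρ ρ)) h.coassoc_var
  simp only [map_add, map_map_assoc_tmul, TensorProduct.map_tmul, map_comul_map, hρj,
    h.comul_var, hz, hρ, TensorProduct.map_id, LinearMap.id_apply, TensorProduct.zero_tmul,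
    TensorProduct.tmul_zero, TensorProduct.assoc_tmul, TensorProduct.add_tmul,
    TensorProduct.tmul_add, map_zero, add_zero, zero_add] at h1
  rw [add_comm]
  exact h1

/-- The comultiplication of `H` applied to the relation `z a = τ(a) z + δ(a)` for a primitive
element `a`. -/
theorem comul_relation {a : A} (ha : IsPrim k a) :
    (z ⊗ₜ[k] 1 + j x ⊗ₜ[k] j y + 1 ⊗ₜ[k] z) * (j a ⊗ₜ[k] 1 + 1 ⊗ₜ[k] j a) =
      Coalgebra.comul (R := k) (j (τ a)) * (z ⊗ₜ[k] 1 + j x ⊗ₜ[k] j y + 1 ⊗ₜ[k] z) +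
        Coalgebra.comul (R := k) (j (δ a)) := by
  have hz : Coalgebra.comul (R := k) z = z ⊗ₜ[k] 1 + j x ⊗ₜ[k] j y + 1 ⊗ₜ[k] z := by
    simpa using h.comul_var
  have h1 := congrArg (Coalgebra.comul (R := k)) (h.ore.mul_map a)
  have hja : Coalgebra.comul (R := k) (j a) = j a ⊗ₜ[k] 1 + 1 ⊗ₜ[k] j a := by
    rw [comul_map, show Coalgebra.comul (R := k) a = _ from ha]
    simp
  rw [map_add, Bialgebra.comul_mul, Bialgebra.comul_mul, hz] at h1
  rw [← hja]
  exact h1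

theorem map_eq_add_algebraMap {a : A} (ha : IsPrim k a) :
    τ a = a + algebraMap k A (Coalgebra.counit (R := k) (τ a)) := by
  obtain ⟨ρ, π, hρ, hρz, hπ, hπz⟩ := h.exists_coeff
  have hz : π z = 1 := by simpa using hπz 1
  have hρ1 : ρ 1 = 1 := by simpa using hρ 1
  have hπ1 : π 1 = 0 := by simpa using hπ 1
  have hρj : ρ ∘ₗ (j : A →ₗ[k] H) = LinearMap.id := LinearMap.ext hρ
  have hπj : π ∘ₗ (j : A →ₗ[k] H) = 0 := LinearMap.ext hπ
  have hza : π (z * j a) = τ a := by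
    rw [show z * j a = _ from h.ore.mul_map a, map_add]
    change π (j (τ a) * z) + π (j (δ a)) = τ a
    rw [hπz, hπ, add_zero]
  have h1 := congrArg (TensorProduct.map π ρ) (h.comul_relation ha)
  have hT (t : A ⊗[k] A) : TensorProduct.map π ρ
      (TensorProduct.map (j : A →ₗ[k] H) (j : A →ₗ[k] H) t *
        (z ⊗ₜ[k] 1 + j x ⊗ₜ[k] j y + 1 ⊗ₜ[k] z)) = t := by
    induction t with
    | zero => simp
    | add s t hs ht => simp only [map_add, add_mul, hs, ht]
    | tmul b c =>
      simp [mul_add, hπz, hρ, hπ, ← map_mul]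
  rw [comul_map, map_add, hT, map_comul_map, hπj] at h1
  simp only [add_mul, mul_add, Algebra.TensorProduct.tmul_mul_tmul, ← map_mul, mul_one, one_mul,
    map_add, TensorProduct.map_tmul, hza, hz, hπ, hπ1, hρ, hρ1, TensorProduct.zero_tmul, add_zero,
    TensorProduct.map_zero_left, LinearMap.zero_apply] at h1
  have h2 := congrArg (TensorProduct.lid k A) (Coalgebra.rTensor_counit_comul (R := k) (τ a))
  rw [← h1] at h2
  simp only [map_add, LinearMap.rTensor_tmul, TensorProduct.lid_tmul, Bialgebra.counit_one,
    one_smul] at h2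
  rw [Algebra.algebraMap_eq_smul_one, add_comm]
  exact h2.symm

theorem comul_derivation {a : A} (ha : IsPrim k a) :
    Coalgebra.comul (R := k) (δ a) =
      δ a ⊗ₜ[k] 1 + 1 ⊗ₜ[k] δ a + (x * a - a * x) ⊗ₜ[k] y + x ⊗ₜ[k] (y * a - a * y)
        - Coalgebra.counit (R := k) (τ a) • (x ⊗ₜ[k] y) := by
  obtain ⟨ρ, π, hρ, hρz, hπ, hπz⟩ := h.exists_coeff
  have hz : ρ z = 0 := by simpa using hρz 1
  have hρ1 : ρ 1 = 1 := by simpa using hρ 1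
  have hρj : ρ ∘ₗ (j : A →ₗ[k] H) = LinearMap.id := LinearMap.ext hρ
  have hza : ρ (z * j a) = δ a := by
    rw [show z * j a = _ from h.ore.mul_map a, map_add]
    change ρ (j (τ a) * z) + ρ (j (δ a)) = δ a
    rw [hρz, hρ, zero_add]
  have h1 := congrArg (TensorProduct.map ρ ρ) (h.comul_relation ha)
  have hT (t : A ⊗[k] A) : TensorProduct.map ρ ρ
      (TensorProduct.map (j : A →ₗ[k] H) (j : A →ₗ[k] H) t *
        (z ⊗ₜ[k] 1 + j x ⊗ₜ[k] j y + 1 ⊗ₜ[k] z)) = t * x ⊗ₜ[k] y := by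
    induction t with
    | zero => simp
    | add s t hs ht => simp only [map_add, add_mul, hs, ht]
    | tmul b c =>
      simp [mul_add, hρz, hρ, ← map_mul]
  rw [comul_map, map_add, hT, map_comul_map, hρj, h.map_eq_add_algebraMap ha, map_add,
    Bialgebra.comul_algebraMap, show Coalgebra.comul (R := k) a = _ from ha] at h1
  simp only [add_mul, mul_add, Algebra.TensorProduct.tmul_mul_tmul, ← map_mul, mul_one, one_mul,
    map_add, TensorProduct.map_tmul, hza, hz, hρ, hρ1, TensorProduct.zero_tmul, add_zero, zero_add,
    TensorProduct.tmul_zero, TensorProduct.map_id, LinearMap.id_apply, ← Algebra.smul_def] at h1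
  rw [TensorProduct.sub_tmul, TensorProduct.tmul_sub, ← sub_eq_of_eq_add' h1]
  abel

end IsGeneralizedHopfOre

end Coproduct

/-! ### The twisting character -/

section Character

attribute [local instance 100] LieRing.ofAssociativeRing

/-- The character `a ↦ ε(τ(a))` of the Lie algebra `L` attached to an endomorphism `τ` of `U(L)`. -/
def twistCharacter {k L : Type*} [Field k] [LieRing L] [LieAlgebra k L]
    (τ : UniversalEnvelopingAlgebra k L →ₐ[k] UniversalEnvelopingAlgebra k L) :
    LieAlgebra.LieCharacter k L where
  toFun a := Coalgebra.counit (R := k) (τ (UniversalEnvelopingAlgebra.ι k a))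
  map_add' a b := by simp only [map_add]
  map_smul' c a := by simp only [map_smul, RingHom.id_apply]
  map_lie' {a b} := by
    simp only [LieHom.map_lie, LieRing.of_associative_ring_bracket, map_sub, map_mul,
      Bialgebra.counit_mul]

theorem lift_twistCharacter {k L : Type*} [Field k] [LieRing L] [LieAlgebra k L]
    (τ : UniversalEnvelopingAlgebra k L →ₐ[k] UniversalEnvelopingAlgebra k L)
    (u : UniversalEnvelopingAlgebra k L) :
    UniversalEnvelopingAlgebra.lift k (twistCharacter τ) u =
      Coalgebra.counit (R := k) (τ u) := by
  have h : UniversalEnvelopingAlgebra.lift k (twistCharacter τ) =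
      (Bialgebra.counitAlgHom k _).comp τ :=
    UniversalEnvelopingAlgebra.hom_ext_apply fun a =>
      UniversalEnvelopingAlgebra.lift_ι_apply k _ a
  exact DFunLike.congr_fun h u

end Character

end

end HopfOre

theorem proposition2p3 {k : Type*} [Field k] {𝔤 : Type*} [LieRing 𝔤] [LieAlgebra k 𝔤]
    {H : Type*} [Ring H] [HopfAlgebra k H]
    (τ : UniversalEnvelopingAlgebra k 𝔤 →ₐ[k] UniversalEnvelopingAlgebra k 𝔤)
    (δ : UniversalEnvelopingAlgebra k 𝔤 →ₗ[k] UniversalEnvelopingAlgebra k 𝔤)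
    (j : UniversalEnvelopingAlgebra k 𝔤 →ₐc[k] H) (z : H)
    (r₁ r₂ x y : UniversalEnvelopingAlgebra k 𝔤)
    (hH : HopfOre.IsGeneralizedHopfOre τ δ j z r₁ r₂ x y) :
    r₁ = 1 ∧ r₂ = 1 ∧
    (HopfOre.IsNormalized k r₁ r₂ x y →
      (CharZero k →
        (∃ a : 𝔤, x = UniversalEnvelopingAlgebra.ι k a) ∧
        (∃ b : 𝔤, y = UniversalEnvelopingAlgebra.ι k b)) ∧
      (∀ p : ℕ, p.Prime → CharP k p → x ∈ HopfOre.hat k 𝔤 p ∧ y ∈ HopfOre.hat k 𝔤 p)) ∧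
    ∃ χ : LieAlgebra.LieCharacter k 𝔤,
      -- `H` is presented by `U(𝔤)`, `z` and the relations `z a = (a + χ(a)) z + δ(a)`, `a ∈ 𝔤`
      HopfOre.IsPresentedBy (j : UniversalEnvelopingAlgebra k 𝔤 →ₐ[k] H) z
        (fun a : 𝔤 => UniversalEnvelopingAlgebra.ι k a)
        (fun a : 𝔤 => UniversalEnvelopingAlgebra.ι k a + algebraMap k _ (χ a))
        (fun a : 𝔤 => δ (UniversalEnvelopingAlgebra.ι k a)) ∧
      -- `τ = id + χ` on `𝔤`, and the coproduct condition holds on `𝔤`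
      (∀ a : 𝔤,
        τ (UniversalEnvelopingAlgebra.ι k a) =
          UniversalEnvelopingAlgebra.ι k a + algebraMap k _ (χ a) ∧
        HopfOre.CoproductCondition χ δ x y (UniversalEnvelopingAlgebra.ι k a)) ∧
      -- in characteristic `p`, both also hold on the restricted closure of `𝔤`
      (∀ p : ℕ, p.Prime → CharP k p → ∀ a ∈ HopfOre.hat k 𝔤 p,
        τ a = a + algebraMap k _ (UniversalEnvelopingAlgebra.lift k χ a) ∧
        HopfOre.CoproductCondition χ δ x y a) := by
  have h1 : r₁ = 1 := HopfOre.eq_one_of_isGroupLikeElem_enveloping hH.isGroupLikeElem_left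
  have h2 : r₂ = 1 := HopfOre.eq_one_of_isGroupLikeElem_enveloping hH.isGroupLikeElem_right
  subst h1 h2
  have hχ (a : UniversalEnvelopingAlgebra k 𝔤) (ha : HopfOre.IsPrim k a) :
      τ a = a + algebraMap k _
        (UniversalEnvelopingAlgebra.lift k (HopfOre.twistCharacter τ) a) ∧
      HopfOre.CoproductCondition (HopfOre.twistCharacter τ) δ x y a := by
    rw [HopfOre.CoproductCondition, HopfOre.lift_twistCharacter]
    exact ⟨hH.map_eq_add_algebraMap ha, hH.comul_derivation ha⟩
  have hτ (a : 𝔤) : τ (UniversalEnvelopingAlgebra.ι k a) =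
      UniversalEnvelopingAlgebra.ι k a + algebraMap k _ (HopfOre.twistCharacter τ a) :=
    hH.map_eq_add_algebraMap (HopfOre.isPrim_ι a)
  refine ⟨rfl, rfl, fun hN => ?_, HopfOre.twistCharacter τ, ?_,
    fun a => ⟨hτ a, (hχ _ (HopfOre.isPrim_ι a)).2⟩, fun p hp _ a ha => ?_⟩
  · obtain ⟨hx, hy⟩ := HopfOre.isPrim_of_cocycle
      (fun g hg => HopfOre.eq_one_of_isGroupLikeElem_enveloping hg) hH.cocycle hN.zero_iff
      hN.not_multiple
    refine ⟨fun _ => ⟨HopfOre.exists_ι_eq_of_isPrim hx, HopfOre.exists_ι_eq_of_isPrim hy⟩,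
      fun p hp _ => ?_⟩
    have : ExpChar k p := ExpChar.prime hp
    exact ⟨HopfOre.mem_hat_of_isPrim p hx, HopfOre.mem_hat_of_isPrim p hy⟩
  · simp only [← hτ]
    exact hH.ore.isPresentedBy HopfOre.adjoin_range_ι
  · have : ExpChar k p := ExpChar.prime hp
    exact hχ a (HopfOre.isPrim_of_mem_hat p ha)
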